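/- **Theorem 1.** Let $\mathcal E$ be an ellipse in $\mathbb R^2$ with centre $c$ and semiaxes $a,b>0$ in the directions of the positively oriented orthonormal frame $(u,v)$. Put $A=(ab)^{1/3}$, $L=2\pi A$, and let $$N(t)=a\cos\tfrac tA\,u+b\sin\tfrac tA\,v,\qquad e(t)=c+N(t),\qquad t\in\mathbb R,$$ be the rescaled affine normal and the affine arc-length parametrization of $\mathcal E$. For an $L$-periodic function $n:\mathbb R\to\mathbb R$ let $\mathcal E+n$ be the closed curve $\gamma(t)=e(t)+n(t)N(t)$, and let $\|n\|_{C^k}=\sum_{j=0}^k\max_{t\in[0,L]}|n^{(j)}(t)|$. For every $K>0$ there is $\varepsilon>0$, depending only on $\mathcal E$ and $K$, such that the following holds. Let $\Omega\subset\mathbb R^2$ be a bounded domain (a connected open set) with boundary $\partial\Omega=\mathcal E+n$, where $n$ is $L$-periodic of class $C^{127}$, $\|n\|_{C^{127}}\le K$ and $\|n\|_{C^1}\le\varepsilon$. If the symplectic billiard map of $\Omega$ is rationally integrable, then $\Omega$ is an ellipse (the open region enclosed by some ellipse). Here, with $\omega$ the standard area form, the phase cylinder is the quotient of $\{(s,t):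 s<t<s+L,\ \omega(\dot\gamma(s),\dot\gamma(t))>0\}$ by the translation by $(L,L)$, and the symplectic billiard map $T$ sends $(t_1,t_2)$ to the point $(t_2,t_3)$ of the phase cylinder for which $\gamma(t_3)-\gamma(t_1)$ is a positive multiple of $\dot\gamma(t_2)$. The map $T$ is *rationally integrable* if for every integer $q\ge3$ there is an invariant curve for $T$ (a homotopically nontrivial simple closed curve $C$ in the phase cylinder with $T(C)=C$) that has rotation number $\frac1q$ (for the orbits $(t_j,t_{j+1})_{j\ge0}$ of $T$ on $C$, lifted to the universal cover, $t_j/(jL)\to\frac1q$ as $j\to\infty$) and consists entirely of $q$-periodic orbits. -/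

import Mathlib

open Set Filter Topology

noncomputable section

namespace SymplecticBilliard

/-- The Euclidean plane. -/
abbrev Plane : Type := EuclideanSpace ℝ (Fin 2)

/-- The standard area form on the plane. -/
def area (x y : Plane) : ℝ := x 0 * y 1 - x 1 * y 0

/-- An ellipse, given by its centre, its semiaxes and the angle between the first coordinate
direction and the axis of semiaxis length `a`. -/
structure Ellipse where
  center : Plane
  angle : ℝ
  a : ℝ
  b : ℝ
  a_pos : 0 < a
  b_pos : 0 < b

namespace Ellipse

/-- The normalized area, i.e. the cube root of (enclosed area) / π; the enclosed area is
`π * a * b`. -/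
def alpha (E : Ellipse) : ℝ := (E.a * E.b) ^ (1 / 3 : ℝ)

/-- The period `2 π α` of the affine arc-length parametrization. -/
def period (E : Ellipse) : ℝ := 2 * Real.pi * E.alpha

/-- The rescaled affine normal `N` (directed outwards): the vector from the centre to the point of
affine arc-length parameter `t`. -/
def normal (E : Ellipse) (t : ℝ) : Plane :=
  (E.a * Real.cos (t / E.alpha)) • !₂[Real.cos E.angle, Real.sin E.angle] +
    (E.b * Real.sin (t / E.alpha)) • !₂[-Real.sin E.angle, Real.cos E.angle]

/-- The affine arc-length parametrization of the ellipse. -/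
def param (E : Ellipse) (t : ℝ) : Plane := E.center + E.normal t

/-- The parametrization `t ↦ e(t) + n(t) N(t)` of the deformed curve `E + n`. -/
def deform (E : Ellipse) (n : ℝ → ℝ) (t : ℝ) : Plane := E.param t + n t • E.normal t

/-- The open region enclosed by the ellipse. -/
def region (E : Ellipse) : Set Plane :=
  {x | ∃ t r : ℝ, 0 ≤ r ∧ r < 1 ∧ x = E.center + r • E.normal t}

end Ellipse

/-- The `C^k` norm on `[0, L]`: the sum over `j ≤ k` of the maxima of `|f^(j)|`. -/
def normC (L : ℝ) (k : ℕ) (f : ℝ → ℝ) : ℝ :=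
  ∑ j ∈ Finset.range (k + 1), sSup ((fun x => |iteratedDeriv j f x|) '' Icc 0 L)

/-- The phase space of symplectic billiards in the curve `γ` of period `L`, lifted to the universal
cover: pairs of parameters `s < t < s + L` with positively oriented tangents. The phase cylinder is
the quotient by the translation by `(L, L)`. -/
def phase (γ : ℝ → Plane) (L : ℝ) : Set (ℝ × ℝ) :=
  {p | p.1 < p.2 ∧ p.2 < p.1 + L ∧ 0 < area (deriv γ p.1) (deriv γ p.2)}

/-- `T` is the (lift of the) symplectic billiard map of `γ`: it sends `(t₁, t₂)` to `(t₂, t₃)`,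
where `γ t₃ - γ t₁` is positively parallel to the tangent at `γ t₂`. -/
def IsBilliardMap (γ : ℝ → Plane) (L : ℝ) (T : ℝ × ℝ → ℝ × ℝ) : Prop :=
  ∀ p ∈ phase γ L, T p ∈ phase γ L ∧ (T p).1 = p.2 ∧
    ∃ c : ℝ, 0 < c ∧ γ (T p).2 - γ p.1 = c • deriv γ p.2

/-- `c` lifts a homotopically nontrivial simple closed curve (parametrized by `ℝ / ℤ`) in the phase
cylinder. -/
def IsEssentialCurve (γ : ℝ → Plane) (L : ℝ) (c : ℝ → ℝ × ℝ) : Prop :=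
  Continuous c ∧ (∀ u, c u ∈ phase γ L) ∧
    (∃ k : ℤ, k ≠ 0 ∧ ∀ u, c (u + 1) = c u + (k * L, k * L)) ∧
    (∀ (u v : ℝ) (m : ℤ), c u = c v + (m * L, m * L) → ∃ l : ℤ, u = v + l)

/-- The preimage in the universal cover of the curve in the phase cylinder lifted by `c`. -/
def trace (L : ℝ) (c : ℝ → ℝ × ℝ) : Set (ℝ × ℝ) :=
  {p | ∃ (u : ℝ) (m : ℤ), p = c u + (m * L, m * L)}

/-- The orbit of `p` under `T` has rotation number `ρ`: the average advance along the curve per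
step, as a fraction of the period, is `ρ`. -/
def HasRotationNumber (L : ℝ) (T : ℝ × ℝ → ℝ × ℝ) (p : ℝ × ℝ) (ρ : ℝ) : Prop :=
  Tendsto (fun j : ℕ => (T^[j] p).1 / (j * L)) atTop (𝓝 ρ)

/-- The orbit of the point of the phase cylinder represented by `p` is `q`-periodic. -/
def IsPeriodicOrbit (L : ℝ) (T : ℝ × ℝ → ℝ × ℝ) (q : ℕ) (p : ℝ × ℝ) : Prop :=
  ∃ m : ℤ, T^[q] p = p + (m * L, m * L)

/-- The symplectic billiard map of the closed curve `γ` of period `L` is rationally integrable: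
for each `q ≥ 3` it has an invariant curve of rotation number `1 / q` that consists entirely of
`q`-periodic orbits. -/
def RationallyIntegrable (γ : ℝ → Plane) (L : ℝ) : Prop :=
  ∃ T : ℝ × ℝ → ℝ × ℝ, IsBilliardMap γ L T ∧
    ∀ q : ℕ, 3 ≤ q → ∃ c : ℝ → ℝ × ℝ, IsEssentialCurve γ L c ∧
      T '' trace L c = trace L c ∧
      ∀ p ∈ trace L c, HasRotationNumber L T p (1 / q) ∧ IsPeriodicOrbit L T q p

end SymplecticBilliard

end

open Set Filter Topology

noncomputable section

namespace SymplecticBilliard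

/-- The standard area form in complex notation. -/
def cross (z w : ℂ) : ℝ := ((starRingEnd ℂ) z * w).im

/-- The closed curve with polar equation `log r = s`. -/
def logPolar (s : ℝ → ℝ) (t : ℝ) : ℂ := Complex.exp (s t + t * Complex.I)

/-- `t` lists the vertices of a `q`-gon inscribed in `γ` that closes up after one turn and is an
orbit of the symplectic billiard in `γ`. -/
structure IsPolygon (γ : ℝ → ℂ) (L : ℝ) (q : ℕ) (t : ℕ → ℝ) : Prop where
  lt : ∀ j ≤ q, t j < t (j + 1)
  lt_add : ∀ j ≤ q, t (j + 1) < t j + L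
  cross_pos : ∀ j ≤ q, 0 < cross (deriv γ (t j)) (deriv γ (t (j + 1)))
  critical : ∀ j < q, cross (γ (t (j + 2)) - γ (t j)) (deriv γ (t (j + 1))) = 0
  closed : t q = t 0 + L
  closed' : t (q + 1) = t 1 + L

/-- Through each point of `γ` there are billiard polygons with any number of vertices. -/
def HasPolygons (γ : ℝ → ℂ) (L : ℝ) : Prop :=
  ∀ q : ℕ, 3 ≤ q → ∀ θ : ℝ, ∃ t : ℕ → ℝ, t 0 = θ ∧ IsPolygon γ L q t

theorem cross_mul_exp (a b : ℂ) (u v x y : ℝ) :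
    cross (a * Complex.exp (u + x * Complex.I)) (b * Complex.exp (v + y * Complex.I)) =
      Real.exp (u + v) * (cross a b * Real.cos (y - x) +
        ((starRingEnd ℂ) a * b).re * Real.sin (y - x)) := by
  have h : (starRingEnd ℂ) (a * Complex.exp (u + x * Complex.I)) *
      (b * Complex.exp (v + y * Complex.I)) =
      ((Real.exp (u + v) : ℝ) : ℂ) * (((starRingEnd ℂ) a * b) *
        Complex.exp (((y - x : ℝ) : ℂ) * Complex.I)) := by
    rw [map_mul, ← Complex.exp_conj, Complex.ofReal_exp]
    have : Complex.exp ((starRingEnd ℂ) (u + x * Complex.I)) * Complex.exp (v + y * Complex.I) =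
        Complex.exp ((u + v : ℝ) : ℂ) * Complex.exp (((y - x : ℝ) : ℂ) * Complex.I) := by
      rw [← Complex.exp_add, ← Complex.exp_add]
      congr 1
      simp
      ring
    linear_combination ((starRingEnd ℂ) a * b) * this
  unfold cross
  rw [h, Complex.im_ofReal_mul, Complex.mul_im,
    Complex.exp_ofReal_mul_I_re, Complex.exp_ofReal_mul_I_im]
  ring

theorem hasDerivAt_logPolar {s : ℝ → ℝ} {t s' : ℝ} (h : HasDerivAt s s' t) :
    HasDerivAt (logPolar s) ((s' + Complex.I) * logPolar s t) t := by
  have h1 : HasDerivAt (fun t : ℝ => ((s t : ℂ) + t * Complex.I)) (s' + 1 * Complex.I) t :=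
    h.ofReal_comp.add ((hasDerivAt_id t).ofReal_comp.mul_const _)
  have h2 := h1.cexp
  rw [one_mul, mul_comm] at h2
  exact h2

theorem cross_deriv_logPolar {s : ℝ → ℝ} (hs : Differentiable ℝ s) (x y : ℝ) :
    cross (deriv (logPolar s) x) (deriv (logPolar s) y) = Real.exp (s x + s y) *
      ((1 + deriv s x * deriv s y) * Real.sin (y - x) +
        (deriv s x - deriv s y) * Real.cos (y - x)) := by
  rw [(hasDerivAt_logPolar (hs x).hasDerivAt).deriv, (hasDerivAt_logPolar (hs y).hasDerivAt).deriv,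
    logPolar, logPolar, cross_mul_exp]
  simp [cross]
  ring

theorem cross_sub_deriv_logPolar {s : ℝ → ℝ} (hs : Differentiable ℝ s) (x y z : ℝ) :
    cross (logPolar s z - logPolar s x) (deriv (logPolar s) y) =
      Real.exp (s z + s y) * (Real.cos (z - y) - deriv s y * Real.sin (z - y)) -
      Real.exp (s x + s y) * (Real.cos (y - x) + deriv s y * Real.sin (y - x)) := by
  have key : ∀ w, cross (logPolar s w) (deriv (logPolar s) y) =
      Real.exp (s w + s y) * (Real.cos (y - w) + deriv s y * Real.sin (y - w)) := by
    intro w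
    have := cross_mul_exp 1 (deriv s y + Complex.I) (s w) (s y) w y
    rw [one_mul] at this
    rw [(hasDerivAt_logPolar (hs y).hasDerivAt).deriv, logPolar, logPolar, this]
    simp [cross]
  have h2 : cross (logPolar s z - logPolar s x) (deriv (logPolar s) y) =
      cross (logPolar s z) (deriv (logPolar s) y) - cross (logPolar s x) (deriv (logPolar s) y) := by
    simp only [cross, map_sub, sub_mul, Complex.sub_im]
  rw [h2, key, key, ← neg_sub z y, Real.cos_neg, Real.sin_neg]
  ring

theorem mul_le_sin' {x : ℝ} (h0 : 0 ≤ x) (h1 : x ≤ Real.pi / 2) : 0.6 * x ≤ Real.sin x := by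
  have h := Real.mul_le_sin h0 h1
  have : (0.6 : ℝ) ≤ 2 / Real.pi := by
    rw [le_div_iff₀ Real.pi_pos]; linarith [Real.pi_lt_d2]
  nlinarith

theorem angle_le_of_cross_pos {a b η d : ℝ} (ha : |a| ≤ η) (hb : |b| ≤ η) (hη : η ≤ 1 / 100)
    (hab : |a - b| ≤ η * (2 * Real.pi - d)) (hd : d < 2 * Real.pi)
    (h : 0 < (1 + a * b) * Real.sin d + (a - b) * Real.cos d) : d ≤ Real.pi + 6 * η := by
  have hη0 : 0 ≤ η := (abs_nonneg a).trans ha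
  by_contra! hc
  obtain ⟨x, rfl⟩ : ∃ x, d = 2 * Real.pi - x := ⟨2 * Real.pi - d, by ring⟩
  rw [Real.sin_two_pi_sub, Real.cos_two_pi_sub] at h
  have hx0 : 0 < x := by linarith
  have hx1 : x < Real.pi := by linarith
  have hab1 : |a * b| ≤ 1 / 100 * (1 / 100) := by
    rw [abs_mul]
    exact mul_le_mul (ha.trans hη) (hb.trans hη) (abs_nonneg _) (by norm_num)
  have h1 : (a - b) * Real.cos x ≤ η * x := by
    have : |(a - b) * Real.cos x| ≤ η * x := by
      rw [abs_mul]
      calc |a - b| * |Real.cos x| ≤ |a - b| * 1 := by gcongr; exact Real.abs_cos_le_one _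
        _ ≤ η * x := by linarith
    exact (le_abs_self _).trans this
  have h2 : 0.9 * Real.sin x ≤ η * x := by
    have hs := Real.sin_nonneg_of_nonneg_of_le_pi hx0.le hx1.le
    have := (abs_le.1 hab1).1
    nlinarith
  rcases le_total x (Real.pi / 2) with hx | hx
  · have := mul_le_sin' hx0.le hx
    nlinarith
  · have := mul_le_sin' (x := Real.pi - x) (by linarith) (by linarith)
    rw [Real.sin_pi_sub] at this
    have h3 : η * x ≤ η * 3.15 := by gcongr; linarith [Real.pi_lt_d2]
    linarith

theorem abs_cos_sub_cos_le {η b u v x y : ℝ} (hb : |b| ≤ η) (hu : |u| ≤ η) (hv : |v| ≤ η)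
    (hη : η ≤ 1 / 100)
    (h : Real.exp u * (Real.cos x - b * Real.sin x) = Real.exp v * (Real.cos y + b * Real.sin y)) :
    |Real.cos x - Real.cos y| ≤ 7 * η := by
  have hη0 : 0 ≤ η := (abs_nonneg _).trans hb
  have hexp : ∀ w : ℝ, |w| ≤ η → |Real.exp w - 1| ≤ 2 * η := fun w hw =>
    (Real.abs_exp_sub_one_le (by linarith)).trans (by linarith)
  have hexp' : ∀ w : ℝ, |w| ≤ η → |Real.exp w| ≤ 1.1 := fun w hw => by
    have := (abs_le.1 (hexp w hw)).2
    rw [abs_of_pos (Real.exp_pos _)]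
    linarith
  have e : Real.cos x - Real.cos y = (1 - Real.exp u) * Real.cos x + Real.exp u * (b * Real.sin x)
      + ((Real.exp v - 1) * Real.cos y + Real.exp v * (b * Real.sin y)) := by
    linear_combination h
  have A : ∀ w z : ℝ, |w| ≤ η → |(Real.exp w - 1) * Real.cos z| ≤ 2 * η := fun w z hw => by
    rw [abs_mul]
    calc _ ≤ 2 * η * 1 := mul_le_mul (hexp w hw) (Real.abs_cos_le_one _) (abs_nonneg _) (by linarith)
      _ = _ := mul_one _
  have B : ∀ w z : ℝ, |w| ≤ η → |Real.exp w * (b * Real.sin z)| ≤ 1.1 * η := fun w z hw => by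
    rw [abs_mul, abs_mul]
    have : |b| * |Real.sin z| ≤ η * 1 :=
      mul_le_mul hb (Real.abs_sin_le_one _) (abs_nonneg _) (by linarith)
    exact mul_le_mul (hexp' w hw) (by linarith) (by positivity) (by norm_num)
  have A1 := A u x hu
  rw [← abs_neg, ← neg_mul, neg_sub] at A1
  rw [e]
  refine (abs_add_le _ _).trans ?_
  have h1 := abs_add_le ((1 - Real.exp u) * Real.cos x) (Real.exp u * (b * Real.sin x))
  have h2 := abs_add_le ((Real.exp v - 1) * Real.cos y) (Real.exp v * (b * Real.sin y))
  linarith [A v y hv, B u x hu, B v y hv]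

theorem cos_le_cos_of_le_two_pi_sub {δ d : ℝ} (h0 : 0 ≤ δ) (h1 : δ ≤ d)
    (h2 : d ≤ 2 * Real.pi - δ) : Real.cos d ≤ Real.cos δ := by
  rcases le_total d Real.pi with h | h
  · exact Real.cos_le_cos_of_nonneg_of_le_pi h0 h h1
  · rw [← Real.cos_two_pi_sub d]
    exact Real.cos_le_cos_of_nonneg_of_le_pi h0 (by linarith) (by linarith)

theorem abs_sub_le_of_abs_cos_sub_cos_le {q : ℕ} (hq : 3 ≤ q) {d η r : ℝ} (hη0 : 0 ≤ η)
    (hη : 100 * q * η ≤ 1) (h0 : 0 < d) (h1 : d ≤ Real.pi + 6 * η)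
    (h : |Real.cos d - Real.cos (2 * Real.pi / q)| ≤ r) : |d - 2 * Real.pi / q| ≤ 3.2 * q * r := by
  have hq' : (3 : ℝ) ≤ q := by exact_mod_cast hq
  have hq0 : (0 : ℝ) < q := by linarith
  set δ := 2 * Real.pi / q with hδ
  have hδq : δ * q = 2 * Real.pi := by rw [hδ]; field_simp
  have hπ := Real.pi_gt_three
  have hπ' := Real.pi_lt_d2
  have hδ0 : 0 < δ := by positivity
  have hδ3 : δ * 3 ≤ 2 * Real.pi := by nlinarith
  have h6 : 6 * η ≤ δ := by
    by_contra! hc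
    nlinarith
  have hη' : η ≤ 1 / 300 := by nlinarith
  rw [Real.cos_sub_cos, abs_mul, abs_mul] at h
  have hz : 1 / (2 * q) ≤ |Real.sin ((d + δ) / 2)| := by
    refine le_trans ?_ (le_abs_self _)
    rcases le_total ((d + δ) / 2) (Real.pi / 2) with hc | hc
    · have := mul_le_sin' (x := (d + δ) / 2) (by linarith) hc
      refine le_trans ?_ this
      rw [div_le_iff₀ (by positivity)]
      nlinarith
    · have := mul_le_sin' (x := Real.pi - (d + δ) / 2) (by linarith) (by linarith)
      rw [Real.sin_pi_sub] at this
      refine le_trans ?_ this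
      rw [div_le_iff₀ (by positivity)]
      nlinarith
  have hy : |d - δ| / 3.2 ≤ |Real.sin ((d - δ) / 2)| := by
    have e : |Real.sin ((d - δ) / 2)| = |Real.sin (|d - δ| / 2)| := by
      rcases abs_choice (d - δ) with hc | hc <;> rw [hc]
      rw [neg_div, Real.sin_neg, abs_neg]
    rw [e]
    refine le_trans ?_ (le_abs_self _)
    have hle : |d - δ| ≤ Real.pi := abs_le.2 ⟨by linarith, by linarith⟩
    have := Real.mul_le_sin (x := |d - δ| / 2) (by positivity) (by linarith)
    refine le_trans ?_ this
    have h3 : 2 / Real.pi * (|d - δ| / 2) = |d - δ| / Real.pi := by field_simp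
    rw [h3]
    gcongr
    linarith
  have hm : 1 / (2 * q) * (|d - δ| / 3.2) ≤ r / 2 := by
    have h4 : 1 / (2 * q) * (|d - δ| / 3.2) ≤ |Real.sin ((d + δ) / 2)| * |Real.sin ((d - δ) / 2)| :=
      mul_le_mul hz hy (by positivity) (abs_nonneg _)
    have h5 : |(-2 : ℝ)| = 2 := by norm_num
    rw [h5] at h
    linarith
  have : |d - δ| = 1 / (2 * q) * (|d - δ| / 3.2) * (2 * q * 3.2) := by field_simp
  rw [this]
  calc _ ≤ r / 2 * (2 * q * 3.2) := by gcongr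
    _ = _ := by ring

theorem inv_le_sin_two_pi_div {q : ℕ} (hq : 3 ≤ q) : 1 / (q : ℝ) ≤ Real.sin (2 * Real.pi / q) := by
  have hq' : (3 : ℝ) ≤ q := by exact_mod_cast hq
  have hq0 : (0 : ℝ) < q := by linarith
  set δ := 2 * Real.pi / q with hδ
  have hδq : δ * q = 2 * Real.pi := by rw [hδ]; field_simp
  have hπ := Real.pi_gt_three
  have hδ0 : 0 < δ := by positivity
  have hδ3 : δ * 3 ≤ 2 * Real.pi := by nlinarith
  rw [div_le_iff₀ hq0]
  rcases le_total δ (Real.pi / 2) with hc | hc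
  · have := mul_le_sin' hδ0.le hc
    nlinarith
  · have := mul_le_sin' (x := Real.pi - δ) (by linarith) (by linarith)
    rw [Real.sin_pi_sub] at this
    nlinarith


theorem abs_exp_mul_sin_sub_le {u d δ η r : ℝ} (hu : |u| ≤ 2 * η) (hη : 2 * η ≤ 1)
    (h : |d - δ| ≤ r) : |Real.exp u * Real.sin d - Real.sin δ| ≤ 4 * η + r := by
  have e : Real.exp u * Real.sin d - Real.sin δ =
      (Real.exp u - 1) * Real.sin d + (Real.sin d - Real.sin δ) := by ring
  have h1 : |Real.sin d - Real.sin δ| ≤ |d - δ| := Real.abs_sin_sub_sin_le d δ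
  have h2 : |(Real.exp u - 1) * Real.sin d| ≤ 4 * η := by
    rw [abs_mul]
    have h3 : |Real.exp u - 1| ≤ 4 * η :=
      (Real.abs_exp_sub_one_le (by linarith)).trans (by linarith)
    have := mul_le_mul h3 (Real.abs_sin_le_one d) (abs_nonneg _) ((abs_nonneg _).trans h3)
    linarith
  rw [e]
  exact (abs_add_le _ _).trans (by linarith)

section

variable {s : ℝ → ℝ} {η : ℝ} {q : ℕ} {t : ℕ → ℝ}

theorem IsPolygon.exp_mul_eq (hs : Differentiable ℝ s)
    (ht : IsPolygon (logPolar s) (2 * Real.pi) q t) {j : ℕ} (hj : j < q) :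
    Real.exp (s (t (j + 1)) + s (t (j + 2))) * (Real.cos (t (j + 2) - t (j + 1)) -
      deriv s (t (j + 1)) * Real.sin (t (j + 2) - t (j + 1))) =
    Real.exp (s (t j) + s (t (j + 1))) * (Real.cos (t (j + 1) - t j) +
      deriv s (t (j + 1)) * Real.sin (t (j + 1) - t j)) := by
  have := ht.critical j hj
  rw [cross_sub_deriv_logPolar hs] at this
  rw [add_comm (s (t (j + 1)))]
  linarith

/-- The vertices of a billiard polygon in a nearly circular curve are nearly equidistributed. -/
theorem IsPolygon.abs_sub_le (hs : Differentiable ℝ s) (hper : Function.Periodic s (2 * Real.pi))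
    (h0 : ∀ x, |s x| ≤ η) (h1 : ∀ x, |deriv s x| ≤ η)
    (h2 : ∀ x y, |deriv s x - deriv s y| ≤ η * |x - y|) (hq : 3 ≤ q) (hη : 100 * q * η ≤ 1)
    (ht : IsPolygon (logPolar s) (2 * Real.pi) q t) {j : ℕ} (hj : j ≤ q) :
    |t (j + 1) - t j - 2 * Real.pi / q| ≤ 45 * q ^ 2 * η := by
  have hq' : (3 : ℝ) ≤ q := by exact_mod_cast hq
  have hη0 : 0 ≤ η := (abs_nonneg _).trans (h0 0)
  have hη' : η ≤ 1 / 100 := by nlinarith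
  have hπ := Real.pi_gt_three
  have hper' : Function.Periodic (deriv s) (2 * Real.pi) := fun x => by
    rw [← deriv_comp_add_const]
    congr 1
    exact funext hper
  have hup : ∀ i ≤ q, t (i + 1) - t i ≤ Real.pi + 6 * η := by
    intro i hi
    have hc := ht.cross_pos i hi
    rw [cross_deriv_logPolar hs] at hc
    have hc' := pos_of_mul_pos_right hc (Real.exp_pos _).le
    have hlt := ht.lt_add i hi
    refine angle_le_of_cross_pos (h1 _) (h1 _) hη' ?_ (by linarith) hc'
    have := h2 (t i + 2 * Real.pi) (t (i + 1))
    rw [hper'] at this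
    refine this.trans_eq ?_
    rw [abs_of_pos (by linarith)]
    ring
  set δ := 2 * Real.pi / q with hδ
  have hδq : q * δ = 2 * Real.pi := by rw [hδ]; field_simp
  have hδ0 : 0 < δ := by positivity
  have hδ3 : δ * 3 ≤ 2 * Real.pi := by nlinarith
  have hstep : ∀ i < q,
      |Real.cos (t (i + 2) - t (i + 1)) - Real.cos (t (i + 1) - t i)| ≤ 7 * η := by
    intro i hi
    refine abs_cos_sub_cos_le (h1 (t (i + 1))) (h0 (t (i + 2))) (h0 (t i)) hη' ?_
    have := ht.exp_mul_eq hs hi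
    rw [Real.exp_add, Real.exp_add] at this
    have hne := (Real.exp_pos (s (t (i + 1)))).ne'
    apply mul_left_cancel₀ hne
    linarith
  have hchain : ∀ i ≤ q, |Real.cos (t (i + 1) - t i) - Real.cos (t 1 - t 0)| ≤ 7 * η * i := by
    intro i
    induction i with
    | zero => simp
    | succ i ih =>
      intro hi
      have a1 := ih (by omega)
      have a2 := hstep i (by omega)
      have a3 := abs_add_le (Real.cos (t (i + 2) - t (i + 1)) - Real.cos (t (i + 1) - t i))
        (Real.cos (t (i + 1) - t i) - Real.cos (t 1 - t 0))
      rw [sub_add_sub_cancel] at a3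
      push_cast
      show |Real.cos (t (i + 2) - t (i + 1)) - _| ≤ _
      linarith
  have hpair : ∀ i ≤ q, ∀ k ≤ q,
      Real.cos (t (i + 1) - t i) ≤ Real.cos (t (k + 1) - t k) + 14 * q * η := by
    intro i hi k hk
    have a1 := (abs_le.1 (hchain i hi)).2
    have a2 := (abs_le.1 (hchain k hk)).1
    have hi' : (i : ℝ) ≤ q := by exact_mod_cast hi
    have hk' : (k : ℝ) ≤ q := by exact_mod_cast hk
    nlinarith
  have hsum : ∑ i ∈ Finset.range q, (t (i + 1) - t i) = ∑ i ∈ Finset.range q, δ := by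
    rw [Finset.sum_range_sub, ht.closed, Finset.sum_const, Finset.card_range, nsmul_eq_mul]
    linarith
  have hne : (Finset.range q).Nonempty := Finset.nonempty_range_iff.2 (by omega)
  obtain ⟨i0, hi0, hle⟩ := Finset.exists_le_of_sum_le hne hsum.le
  obtain ⟨i1, hi1, hge⟩ := Finset.exists_le_of_sum_le hne hsum.ge
  rw [Finset.mem_range] at hi0 hi1
  have hlow : Real.cos δ ≤ Real.cos (t (i0 + 1) - t i0) :=
    Real.cos_le_cos_of_nonneg_of_le_pi (by linarith [ht.lt i0 hi0.le]) (by linarith) hle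
  have hhigh : Real.cos (t (i1 + 1) - t i1) ≤ Real.cos δ :=
    cos_le_cos_of_le_two_pi_sub hδ0.le hge (by linarith [hup i1 hi1.le])
  have hcos : |Real.cos (t (j + 1) - t j) - Real.cos δ| ≤ 14 * q * η := by
    rw [abs_le]
    constructor
    · linarith [hpair i0 hi0.le j hj]
    · linarith [hpair j hj i1 hi1.le]
  refine (abs_sub_le_of_abs_cos_sub_cos_le hq hη0 hη (by linarith [ht.lt j hj]) (hup j hj)
    hcos).trans ?_
  nlinarith [mul_nonneg (sq_nonneg (q : ℝ)) hη0]

/-- The invariance of the circle under rotations makes the sum of `s'` over the vertices of a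
regular polygon small to second order. -/
theorem IsPolygon.abs_sum_deriv_le (hs : Differentiable ℝ s)
    (hper : Function.Periodic s (2 * Real.pi))
    (h0 : ∀ x, |s x| ≤ η) (h1 : ∀ x, |deriv s x| ≤ η)
    (h2 : ∀ x y, |deriv s x - deriv s y| ≤ η * |x - y|) (hq : 3 ≤ q) (hη : 100 * q * η ≤ 1)
    (ht : IsPolygon (logPolar s) (2 * Real.pi) q t) :
    |∑ j ∈ Finset.range q, deriv s (t 0 + (j + 1 : ℕ) * (2 * Real.pi / q))| ≤ 91 * q ^ 4 * η ^ 2 := by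
  have hq' : (3 : ℝ) ≤ q := by exact_mod_cast hq
  have hη0 : 0 ≤ η := (abs_nonneg _).trans (h0 0)
  have hη' : η ≤ 1 / 100 := by nlinarith
  have hd := fun {j : ℕ} (hj : j ≤ q) => ht.abs_sub_le hs hper h0 h1 h2 hq hη hj
  set δ := 2 * Real.pi / q with hδ
  have hpos : ∀ j ≤ q, |t j - (t 0 + j * δ)| ≤ 45 * q ^ 2 * η * j := by
    intro j
    induction j with
    | zero => simp
    | succ j ih =>
      intro hj
      have a1 := ih (by omega)
      have a2 := hd (j := j) (by omega)
      have a3 := abs_add_le (t (j + 1) - t j - δ) (t j - (t 0 + j * δ))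
      have e : t (j + 1) - (t 0 + ((j + 1 : ℕ) : ℝ) * δ) =
        (t (j + 1) - t j - δ) + (t j - (t 0 + j * δ)) := by push_cast; ring
      rw [e]
      push_cast
      linarith
  set S : ℕ → ℝ := fun j => Real.exp (s (t j) + s (t (j + 1))) * Real.sin (t (j + 1) - t j) with hS
  set C : ℕ → ℝ := fun j => Real.exp (s (t j) + s (t (j + 1))) * Real.cos (t (j + 1) - t j) with hC
  have hSδ : ∀ j ≤ q, |S j - Real.sin δ| ≤ 46 * q ^ 2 * η := by
    intro j hj
    have hu : |s (t j) + s (t (j + 1))| ≤ 2 * η := by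
      have := abs_add_le (s (t j)) (s (t (j + 1)))
      linarith [h0 (t j), h0 (t (j + 1))]
    have := abs_exp_mul_sin_sub_le hu (by linarith) (hd hj)
    refine this.trans ?_
    have : 4 * η ≤ q ^ 2 * η := by gcongr; nlinarith
    linarith
  have hCS : ∀ j < q, C (j + 1) - C j = deriv s (t (j + 1)) * (S (j + 1) + S j) := by
    intro j hj
    have := ht.exp_mul_eq hs hj
    simp only [hC, hS]
    linear_combination this
  have hsum0 : ∑ j ∈ Finset.range q, deriv s (t (j + 1)) * (S (j + 1) + S j) = 0 := by
    rw [← Finset.sum_congr rfl fun j hj => hCS j (Finset.mem_range.1 hj), Finset.sum_range_sub]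
    simp only [hC, ht.closed, ht.closed', zero_add]
    rw [hper, hper, add_sub_add_right_eq_sub, sub_self]
  have hmain : 2 * Real.sin δ * ∑ j ∈ Finset.range q, deriv s (t (j + 1)) =
      -∑ j ∈ Finset.range q,
        deriv s (t (j + 1)) * ((S (j + 1) - Real.sin δ) + (S j - Real.sin δ)) := by
    rw [Finset.mul_sum, ← Finset.sum_neg_distrib, ← sub_eq_zero, ← Finset.sum_sub_distrib, ← hsum0]
    exact Finset.sum_congr rfl fun j _ => by ring
  have hb1 : |2 * Real.sin δ * ∑ j ∈ Finset.range q, deriv s (t (j + 1))| ≤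
      q * (η * (92 * q ^ 2 * η)) := by
    rw [hmain, abs_neg]
    refine (Finset.abs_sum_le_sum_abs _ _).trans ?_
    have : ∀ j ∈ Finset.range q,
        |deriv s (t (j + 1)) * ((S (j + 1) - Real.sin δ) + (S j - Real.sin δ))| ≤
        η * (92 * q ^ 2 * η) := by
      intro j hj
      rw [Finset.mem_range] at hj
      rw [abs_mul]
      refine mul_le_mul (h1 _) ?_ (abs_nonneg _) hη0
      refine (abs_add_le _ _).trans ?_
      linarith [hSδ j hj.le, hSδ (j + 1) hj]
    refine (Finset.sum_le_sum this).trans_eq ?_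
    rw [Finset.sum_const, Finset.card_range, nsmul_eq_mul]
  have hsin := inv_le_sin_two_pi_div hq
  rw [← hδ] at hsin
  have hb2 : |∑ j ∈ Finset.range q, deriv s (t (j + 1))| ≤ 46 * q ^ 4 * η ^ 2 := by
    have hq0 : (0 : ℝ) < q := by linarith
    have hsin0 : 0 < Real.sin δ := lt_of_lt_of_le (by positivity) hsin
    rw [abs_mul, abs_of_pos (by positivity : 0 < 2 * Real.sin δ)] at hb1
    set A := |∑ j ∈ Finset.range q, deriv s (t (j + 1))| with hA
    have hA0 : 0 ≤ A := abs_nonneg _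
    have h3 : 2 * (1 / (q : ℝ)) * A ≤ 2 * Real.sin δ * A := by gcongr
    have h4 : A = 2 * (1 / (q : ℝ)) * A * (q / 2) := by field_simp
    rw [h4]
    calc _ ≤ q * (η * (92 * q ^ 2 * η)) * (q / 2) :=
          mul_le_mul_of_nonneg_right (h3.trans hb1) (by positivity)
      _ = _ := by ring
  have hb3 : |∑ j ∈ Finset.range q, deriv s (t 0 + (j + 1 : ℕ) * δ) -
      ∑ j ∈ Finset.range q, deriv s (t (j + 1))| ≤ 45 * q ^ 4 * η ^ 2 := by
    rw [← Finset.sum_sub_distrib]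
    refine (Finset.abs_sum_le_sum_abs _ _).trans ?_
    have : ∀ j ∈ Finset.range q, |deriv s (t 0 + (j + 1 : ℕ) * δ) - deriv s (t (j + 1))| ≤
        η * (45 * q ^ 2 * η * q) := by
      intro j hj
      rw [Finset.mem_range] at hj
      refine (h2 _ _).trans ?_
      rw [abs_sub_comm]
      have hj' : ((j + 1 : ℕ) : ℝ) ≤ q := by exact_mod_cast hj
      gcongr
      exact (hpos (j + 1) hj).trans (by gcongr)
    refine (Finset.sum_le_sum this).trans_eq ?_
    rw [Finset.sum_const, Finset.card_range, nsmul_eq_mul]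
    ring
  have := abs_add_le (∑ j ∈ Finset.range q, deriv s (t 0 + (j + 1 : ℕ) * δ) -
      ∑ j ∈ Finset.range q, deriv s (t (j + 1))) (∑ j ∈ Finset.range q, deriv s (t (j + 1)))
  rw [sub_add_cancel] at this
  linarith


end

/-- `f` is `m` times continuously differentiable and its derivatives up to order `m` are bounded by
`C`. -/
def HasBoundedDerivs {E : Type*} [NormedAddCommGroup E] [NormedSpace ℝ E] :
    ℕ → ℝ → (ℝ → E) → Prop
  | 0, C, f => Continuous f ∧ ∀ x, ‖f x‖ ≤ C
  | m + 1, C, f => Differentiable ℝ f ∧ (∀ x, ‖f x‖ ≤ C) ∧ HasBoundedDerivs m C (deriv f)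

namespace HasBoundedDerivs

variable {E : Type*} [NormedAddCommGroup E] [NormedSpace ℝ E] {f : ℝ → E} {C C' : ℝ} {m : ℕ}

theorem continuous : ∀ {m : ℕ}, HasBoundedDerivs m C f → Continuous f
  | 0, h => h.1
  | _ + 1, h => h.1.continuous

theorem norm_le : ∀ {m : ℕ}, HasBoundedDerivs m C f → ∀ x, ‖f x‖ ≤ C
  | 0, h => h.2
  | _ + 1, h => h.2.1

theorem mono (hC : C ≤ C') : ∀ {m : ℕ} {f : ℝ → E},
    HasBoundedDerivs m C f → HasBoundedDerivs m C' f
  | 0, _, h => ⟨h.1, fun x => (h.2 x).trans hC⟩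
  | _ + 1, _, h => ⟨h.1, fun x => (h.2.1 x).trans hC, h.2.2.mono hC⟩

theorem of_succ : ∀ {m : ℕ} {f : ℝ → E}, HasBoundedDerivs (m + 1) C f → HasBoundedDerivs m C f
  | 0, _, h => ⟨h.1.continuous, h.2.1⟩
  | _ + 1, _, h => ⟨h.1, h.2.1, h.2.2.of_succ⟩

end HasBoundedDerivs

theorem _root_.Function.Periodic.deriv' {E : Type*} [NormedAddCommGroup E] [NormedSpace ℝ E]
    {f : ℝ → E} {c : ℝ} (h : Function.Periodic f c) : Function.Periodic (deriv f) c := fun x => by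
  rw [← deriv_comp_add_const]
  congr 1
  exact funext h

/-- The Fourier coefficients of a function of period `2π`. -/
def fourierC (f : ℝ → ℂ) (k : ℤ) : ℂ :=
  (1 / (2 * Real.pi) : ℝ) * ∫ x in (0 : ℝ)..(2 * Real.pi), Complex.exp (-(k * x * Complex.I)) * f x

theorem norm_exp_neg_int_mul (k : ℤ) (x : ℝ) : ‖Complex.exp (-(k * x * Complex.I))‖ = 1 := by
  have : -((k : ℂ) * x * Complex.I) = ((-(k * x) : ℝ) : ℂ) * Complex.I := by push_cast; ring
  rw [this, Complex.norm_exp_ofReal_mul_I]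

theorem norm_fourierC_le {f : ℝ → ℂ} {C : ℝ} (h : ∀ x, ‖f x‖ ≤ C) (k : ℤ) :
    ‖fourierC f k‖ ≤ C := by
  have h1 := intervalIntegral.norm_integral_le_of_norm_le_const (a := 0) (b := 2 * Real.pi) (C := C)
    (f := fun x : ℝ => Complex.exp (-(k * x * Complex.I)) * f x)
    (fun x _ => by rw [norm_mul, norm_exp_neg_int_mul, one_mul]; exact h x)
  rw [sub_zero, abs_of_pos Real.two_pi_pos] at h1
  rw [fourierC, norm_mul, Complex.norm_real, Real.norm_of_nonneg (by positivity)]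
  calc _ ≤ 1 / (2 * Real.pi) * (C * (2 * Real.pi)) := by gcongr
    _ = C := by field_simp

theorem exp_neg_int_mul_add_two_pi (k : ℤ) (x : ℝ) :
    Complex.exp (-(k * ((x + 2 * Real.pi : ℝ) : ℂ) * Complex.I)) =
      Complex.exp (-(k * x * Complex.I)) := by
  have : -((k : ℂ) * ((x + 2 * Real.pi : ℝ) : ℂ) * Complex.I) =
      -((k : ℂ) * x * Complex.I) + (-k : ℤ) * (2 * Real.pi * Complex.I) := by push_cast; ring
  rw [this, Complex.exp_add, Complex.exp_int_mul_two_pi_mul_I, mul_one]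

theorem fourierC_deriv {f : ℝ → ℂ} (hf : Differentiable ℝ f) (hf' : Continuous (deriv f))
    (hper : Function.Periodic f (2 * Real.pi)) (k : ℤ) :
    fourierC (deriv f) k = k * Complex.I * fourierC f k := by
  have hu : ∀ x : ℝ, HasDerivAt (fun x : ℝ => Complex.exp (-(k * x * Complex.I)))
      (-(k * Complex.I) * Complex.exp (-(k * x * Complex.I))) x := by
    intro x
    have h1 : HasDerivAt (fun x : ℝ => -((k : ℂ) * x * Complex.I)) (-(k * Complex.I)) x := by
      have := ((((hasDerivAt_id x).ofReal_comp).const_mul (k : ℂ)).mul_const Complex.I).neg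
      rw [Complex.ofReal_one, mul_one] at this
      exact this
    have := h1.cexp
    rwa [mul_comm] at this
  have hcu : Continuous (fun x : ℝ => Complex.exp (-(k * x * Complex.I))) := by fun_prop
  have := intervalIntegral.integral_mul_deriv_eq_deriv_mul (a := 0) (b := 2 * Real.pi)
    (fun x _ => hu x) (fun x _ => (hf x).hasDerivAt)
    ((continuous_const.mul hcu).intervalIntegrable _ _) (hf'.intervalIntegrable _ _)
  rw [fourierC, fourierC, this]
  have e1 := exp_neg_int_mul_add_two_pi k 0
  have e2 := hper 0
  rw [zero_add] at e1 e2
  rw [e1, e2, sub_self, zero_sub]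
  simp only [mul_assoc]
  rw [intervalIntegral.integral_const_mul]
  ring

theorem HasBoundedDerivs.norm_fourierC_mul_le {C : ℝ} (k : ℤ) : ∀ {m : ℕ} {f : ℝ → ℂ},
    HasBoundedDerivs m C f → Function.Periodic f (2 * Real.pi) →
      ‖fourierC f k‖ * |(k : ℝ)| ^ m ≤ C
  | 0, f, h, _ => by simpa using norm_fourierC_le h.2 k
  | m + 1, f, h, hper => by
    have := h.2.2.norm_fourierC_mul_le k hper.deriv'
    rw [fourierC_deriv h.1 h.2.2.continuous hper, norm_mul, norm_mul, Complex.norm_I,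
      Complex.norm_intCast, mul_one] at this
    rw [pow_succ]
    linarith

/-- A summable weight comparable to `k⁻²`. -/
def weight (k : ℤ) : ℝ := 1 / (k : ℝ) ^ 2 + if k = 0 then 1 else 0

theorem summable_weight : Summable weight :=
  (Real.summable_one_div_int_pow.2 (by norm_num)).add
    (summable_of_hasFiniteSupport ((Set.finite_singleton (0 : ℤ)).subset fun k hk => by
      by_contra h
      exact hk (if_neg h)))

theorem weight_of_ne {k : ℤ} (hk : k ≠ 0) : weight k = 1 / (k : ℝ) ^ 2 := by simp [weight, hk]

theorem weight_zero : weight 0 = 1 := by simp [weight]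

theorem norm_le_of_norm_fourierC_le {f : ℝ → ℂ} (hf : Continuous f)
    (hper : Function.Periodic f (2 * Real.pi)) {B : ℝ} (h : ∀ k, ‖fourierC f k‖ ≤ B * weight k)
    (x : ℝ) : ‖f x‖ ≤ B * ∑' k, weight k := by
  have : Fact (0 < 2 * Real.pi) := ⟨Real.two_pi_pos⟩
  let F : C(AddCircle (2 * Real.pi), ℂ) := ⟨hper.lift, continuous_coinduced_dom.2 hf⟩
  have hF : ∀ y : ℝ, F y = f y := fun y => rfl
  have hc : ∀ k, fourierCoeff F k = fourierC f k := by
    intro k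
    rw [fourierCoeff_eq_intervalIntegral F k 0, zero_add, fourierC, Complex.real_smul]
    congr 1
    refine intervalIntegral.integral_congr fun y _ => ?_
    simp only [smul_eq_mul, hF, fourier_coe_apply]
    congr 2
    have : (Real.pi : ℂ) ≠ 0 := by exact_mod_cast Real.pi_ne_zero
    push_cast
    field_simp
  have hsum : Summable fun k => B * weight k := summable_weight.mul_left B
  have hs : Summable (fourierCoeff F) := by
    refine Summable.of_norm_bounded hsum fun k => ?_
    rw [hc]
    exact h k
  have := has_pointwise_sum_fourier_series_of_summable hs (x : AddCircle (2 * Real.pi))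
  rw [← tsum_mul_left, ← hF, ← this.tsum_eq]
  refine tsum_of_norm_bounded hsum.hasSum fun k => ?_
  rw [norm_smul, hc]
  have h1 : ‖fourier k (x : AddCircle (2 * Real.pi))‖ ≤ 1 :=
    ((fourier k).norm_coe_le_norm _).trans_eq (fourier_norm k)
  calc _ ≤ ‖fourierC f k‖ * 1 := by gcongr
    _ ≤ _ := by rw [mul_one]; exact h k

theorem fourierC_comp_add {f : ℝ → ℂ} (hper : Function.Periodic f (2 * Real.pi)) (k : ℤ) {a : ℝ}
    (ha : Complex.exp (k * a * Complex.I) = 1) :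
    fourierC (fun x => f (x + a)) k = fourierC f k := by
  have h1 : ∀ x : ℝ, Complex.exp (-(k * x * Complex.I)) * f (x + a) =
      (fun y : ℝ => Complex.exp (-(k * y * Complex.I)) * f y) (x + a) := by
    intro x
    have : -((k : ℂ) * x * Complex.I) =
      -((k : ℂ) * ((x + a : ℝ) : ℂ) * Complex.I) + k * a * Complex.I := by push_cast; ring
    rw [this, Complex.exp_add, ha, mul_one]
  have hp : Function.Periodic (fun y : ℝ => Complex.exp (-(k * y * Complex.I)) * f y)
      (2 * Real.pi) := fun y => by
    simp only [exp_neg_int_mul_add_two_pi, hper y]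
  rw [fourierC, fourierC]
  congr 1
  rw [intervalIntegral.integral_congr fun x _ => h1 x,
    intervalIntegral.integral_comp_add_right (fun y : ℝ => Complex.exp (-(k * y * Complex.I)) * f y),
    zero_add, add_comm (2 * Real.pi)]
  have := hp.intervalIntegral_add_eq a 0
  rwa [zero_add] at this

theorem norm_fourierC_le_of_sum {f : ℝ → ℂ} (hf : Continuous f)
    (hper : Function.Periodic f (2 * Real.pi)) {q : ℕ} (hq : 0 < q) {R : ℝ}
    (h : ∀ x, ‖∑ j ∈ Finset.range q, f (x + (j + 1 : ℕ) * (2 * Real.pi / q))‖ ≤ R) {k : ℤ}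
    (hk : k = q ∨ k = -q) : q * ‖fourierC f k‖ ≤ R := by
  have hq' : (q : ℂ) ≠ 0 := by exact_mod_cast hq.ne'
  have h1 := norm_fourierC_le h k
  have h2 : fourierC (fun x => ∑ j ∈ Finset.range q, f (x + (j + 1 : ℕ) * (2 * Real.pi / q))) k =
      ∑ j ∈ Finset.range q,
        fourierC (fun x => f (x + (j + 1 : ℕ) * (2 * Real.pi / q))) k := by
    simp only [fourierC]
    rw [← Finset.mul_sum, ← intervalIntegral.integral_finsetSum]
    · simp only [Finset.mul_sum]
    · intro j _
      refine Continuous.intervalIntegrable ?_ _ _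
      fun_prop
  rw [h2, Finset.sum_congr rfl fun j _ => fourierC_comp_add hper k ?_, Finset.sum_const,
    Finset.card_range, nsmul_eq_mul, norm_mul, Complex.norm_natCast] at h1
  · exact h1
  · have e : ∀ l : ℤ, Complex.exp (l * (2 * Real.pi * Complex.I)) = 1 :=
      Complex.exp_int_mul_two_pi_mul_I
    rcases hk with rfl | rfl
    · rw [← e (j + 1)]
      congr 1
      push_cast
      field_simp
    · rw [← e (-(j + 1))]
      congr 1
      push_cast
      field_simp


theorem one_le_tsum_weight : 1 ≤ ∑' k, weight k := by
  have := summable_weight.le_tsum (0 : ℤ) fun k _ => by unfold weight; positivity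
  rwa [weight_zero] at this

/-- How small, relative to the function, the Fourier modes of order at most two have to be. -/
def lowModeRatio : ℝ := 1 / (8 * ∑' k, weight k)

theorem mul_pow_four_le {A X K x M : ℝ} (hA : 0 ≤ A) (hAX : A ≤ X) (hAK : A * x ^ 20 ≤ K)
    (hx : 0 ≤ x) (hM : 1 ≤ M) : A * x ^ 4 ≤ M ^ 4 * X + K / M ^ 16 := by
  have hK : 0 ≤ K := (by positivity : 0 ≤ A * x ^ 20).trans hAK
  have hX : 0 ≤ X := hA.trans hAX
  rcases le_total x M with h | h
  · have : A * x ^ 4 ≤ X * M ^ 4 := by gcongr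
    have : 0 ≤ K / M ^ 16 := by positivity
    linarith
  · have : A * x ^ 4 ≤ K / M ^ 16 := by
      rw [le_div_iff₀ (by positivity)]
      calc A * x ^ 4 * M ^ 16 ≤ A * x ^ 4 * x ^ 16 := by gcongr
        _ = A * x ^ 20 := by ring
        _ ≤ K := hAK
    have : 0 ≤ M ^ 4 * X := by positivity
    linarith

theorem one_le_abs_intCast {k : ℤ} (hk : k ≠ 0) : 1 ≤ |(k : ℝ)| := by
  exact_mod_cast Int.one_le_abs hk

theorem norm_fourierC_mul_pow_le_weight {f : ℝ → ℂ} {X K M : ℝ} (hX : ∀ x, ‖f x‖ ≤ X)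
    (hK : ∀ k : ℤ, ‖fourierC f k‖ * |(k : ℝ)| ^ 20 ≤ K) (hM : 1 ≤ M) {j : ℕ} (hj : j ≤ 2) (k : ℤ) :
    |(k : ℝ)| ^ j * ‖fourierC f k‖ ≤ (M ^ 4 * X + K / M ^ 16) * weight k := by
  have hX0 : 0 ≤ X := (norm_nonneg _).trans (hX 0)
  have hA := norm_fourierC_le hX k
  rcases eq_or_ne k 0 with rfl | hk
  · have hK0 : 0 ≤ K := (by positivity : 0 ≤ ‖fourierC f 0‖ * |((0 : ℤ) : ℝ)| ^ 20).trans (hK 0)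
    have h1 : |((0 : ℤ) : ℝ)| ^ j ≤ 1 := by
      rw [Int.cast_zero, abs_zero]
      exact pow_le_one₀ le_rfl zero_le_one
    rw [weight_zero, mul_one]
    have h2 : 0 ≤ K / M ^ 16 := by positivity
    have h3 : 1 * X ≤ M ^ 4 * X := by gcongr; exact one_le_pow₀ hM
    calc _ ≤ 1 * X := by gcongr
      _ ≤ _ := by linarith
  · have hx := one_le_abs_intCast hk
    rw [weight_of_ne hk, ← sq_abs, mul_one_div, le_div_iff₀ (by positivity)]
    refine le_trans ?_ (mul_pow_four_le (norm_nonneg _) hA (hK k) (abs_nonneg _) hM)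
    calc |(k : ℝ)| ^ j * ‖fourierC f k‖ * |(k : ℝ)| ^ 2
        ≤ |(k : ℝ)| ^ 2 * ‖fourierC f k‖ * |(k : ℝ)| ^ 2 := by gcongr
      _ = _ := by ring

theorem HasPolygons.norm_fourierC_le {s : ℝ → ℝ} {η : ℝ} (hpol : HasPolygons (logPolar s) (2 * Real.pi))
    (hs : Differentiable ℝ s) (hs' : Continuous (deriv s))
    (hper : Function.Periodic s (2 * Real.pi))
    (h0 : ∀ x, |s x| ≤ η) (h1 : ∀ x, |deriv s x| ≤ η)
    (h2 : ∀ x y, |deriv s x - deriv s y| ≤ η * |x - y|) {k : ℤ} (hk : 3 ≤ |(k : ℝ)|)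
    (hη : 100 * |(k : ℝ)| * η ≤ 1) :
    ‖fourierC (fun x => (s x : ℂ)) k‖ ≤ 91 * |(k : ℝ)| ^ 2 * η ^ 2 := by
  set q := k.natAbs with hq
  have hqk : |(k : ℝ)| = q := by rw [hq, Nat.cast_natAbs, Int.cast_abs]
  rw [hqk] at hk hη ⊢
  have hq3 : 3 ≤ q := by exact_mod_cast hk
  have hkq : k = q ∨ k = -q := by omega
  have hd : deriv (fun x => (s x : ℂ)) = fun x => ((deriv s x : ℝ) : ℂ) :=
    funext fun x => (hs x).hasDerivAt.ofReal_comp.deriv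
  have hcd : Continuous (deriv (fun x => (s x : ℂ))) := by
    rw [hd]; exact Complex.continuous_ofReal.comp hs'
  have hper' : Function.Periodic (fun x => (s x : ℂ)) (2 * Real.pi) := fun x => by
    simp only [hper x]
  have key := norm_fourierC_le_of_sum hcd hper'.deriv' (q := q) (by omega)
    (R := 91 * q ^ 4 * η ^ 2) (fun θ => by
      obtain ⟨t, rfl, ht⟩ := hpol q hq3 θ
      have := ht.abs_sum_deriv_le hs hper h0 h1 h2 hq3 hη
      rw [hd, ← Complex.ofReal_sum, Complex.norm_real]
      exact this) hkq
  rw [fourierC_deriv (fun x => (hs x).hasDerivAt.ofReal_comp.differentiableAt) hcd hper', norm_mul,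
    norm_mul, Complex.norm_I, Complex.norm_intCast, hqk, mul_one] at key
  have hq0 : (0 : ℝ) < q := by linarith
  have : (q : ℝ) ^ 2 * ‖fourierC (fun x => (s x : ℂ)) k‖ ≤ q ^ 2 * (91 * q ^ 2 * η ^ 2) := by
    linarith
  exact le_of_mul_le_mul_left this (by positivity)

/-- A nearly circular curve that has billiard polygons with any number of vertices through each
point, and whose low Fourier modes are controlled, is a circle. -/
theorem eq_zero_of_hasPolygons (K : ℝ) : ∃ ε : ℝ, 0 < ε ∧ ∀ s : ℝ → ℝ,
    HasBoundedDerivs 20 K (fun x => (s x : ℂ)) → Function.Periodic s (2 * Real.pi) →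
    (∀ x, |s x| ≤ ε) → HasPolygons (logPolar s) (2 * Real.pi) →
    (∀ X, (∀ x, |s x| ≤ X) → ∀ k : ℤ, |(k : ℝ)| ≤ 2 →
      ‖fourierC (fun x => (s x : ℂ)) k‖ ≤ lowModeRatio * X) →
    ∀ x, s x = 0 := by
  wlog hK : 0 ≤ K generalizing K
  · obtain ⟨ε, hε, h⟩ := this 0 le_rfl
    exact ⟨ε, hε, fun s hs => h s (hs.mono (by linarith))⟩
  set W := ∑' k, weight k with hW
  have hW1 : 1 ≤ W := one_le_tsum_weight
  set D := 2 * W * (91 * (W * (1 + K)) ^ 2 + K) with hD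
  have hD0 : 0 ≤ D := by positivity
  obtain ⟨m, hm⟩ := exists_nat_ge (max (D * 2 ^ 14) (100 * (W * (1 + K))))
  set M0 := m + 1 with hM0
  have hM0D : D * 2 ^ 14 ≤ m := (le_max_left _ _).trans hm
  have hM0W : 100 * (W * (1 + K)) ≤ m := (le_max_right _ _).trans hm
  refine ⟨1 / (M0 : ℝ) ^ 14, by positivity, fun s hs hper hsε hpol hlow => ?_⟩
  set f : ℝ → ℂ := fun x => (s x : ℂ) with hf
  have hfd : Differentiable ℝ f := hs.1
  have hsd : Differentiable ℝ s := fun x =>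
    (Complex.reCLM.hasFDerivAt.comp_hasDerivAt x (hfd x).hasDerivAt).differentiableAt
  have hd : deriv f = fun x => ((deriv s x : ℝ) : ℂ) :=
    funext fun x => (hsd x).hasDerivAt.ofReal_comp.deriv
  have hfd' : Differentiable ℝ (deriv f) := hs.2.2.1
  have hsd' : Differentiable ℝ (deriv s) := fun x => by
    have := (Complex.reCLM.hasFDerivAt.comp_hasDerivAt x (hfd' x).hasDerivAt).differentiableAt
    rw [hd] at this
    exact this
  have hd' : deriv (deriv f) = fun x => ((deriv (deriv s) x : ℝ) : ℂ) := by
    rw [hd]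
    exact funext fun x => (hsd' x).hasDerivAt.ofReal_comp.deriv
  have hfc'' : Continuous (deriv (deriv f)) := hs.2.2.2.2.continuous
  have hfper : Function.Periodic f (2 * Real.pi) := fun x => by simp only [hf, hper x]
  have hbdd : BddAbove (range fun x => |s x|) := ⟨_, by rintro _ ⟨x, rfl⟩; exact hsε x⟩
  set X := sSup (range fun x => |s x|) with hXdef
  have hX : ∀ x, |s x| ≤ X := fun x => le_csSup hbdd ⟨x, rfl⟩
  have hX0 : 0 ≤ X := (abs_nonneg _).trans (hX 0)
  have hXε : X ≤ 1 / (M0 : ℝ) ^ 14 := csSup_le (range_nonempty _) (by rintro _ ⟨x, rfl⟩; exact hsε x)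
  rcases hX0.eq_or_lt with h0 | hXpos
  · exact fun x => abs_nonpos_iff.1 (h0 ▸ hX x)
  exfalso
  have hex : ∃ N : ℕ, 1 < (N : ℝ) ^ 14 * X := by
    obtain ⟨N, hN⟩ := exists_nat_gt (1 / X)
    rw [div_lt_iff₀ hXpos] at hN
    have hN1 : 1 ≤ N := by
      by_contra! h
      interval_cases N
      norm_num at hN
    have : (N : ℝ) ≤ N ^ 14 := le_self_pow₀ (by exact_mod_cast hN1) (by norm_num)
    exact ⟨N, hN.trans_le (by gcongr)⟩
  classical
  have hspec := Nat.find_spec hex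
  set N := Nat.find hex with hN
  have hNpos : M0 < N := by
    by_contra! h
    have h1 : (N : ℝ) ^ 14 * X ≤ M0 ^ 14 * (1 / (M0 : ℝ) ^ 14) := by gcongr
    rw [mul_one_div_cancel (by positivity)] at h1
    linarith
  obtain ⟨M, hMN⟩ : ∃ M, N = M + 1 := ⟨N - 1, by omega⟩
  have hmin : (M : ℝ) ^ 14 * X ≤ 1 := not_lt.1 (Nat.find_min hex (by omega))
  rw [hMN] at hspec
  have hmM : (m : ℝ) + 1 ≤ M := by exact_mod_cast (by omega : m + 1 ≤ M)
  have hM1 : (1 : ℝ) ≤ M := by linarith [(Nat.cast_nonneg m : (0 : ℝ) ≤ m)]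
  have hMpos : (0 : ℝ) < M := by linarith
  set η := (M ^ 4 * X + K / M ^ 16) * W with hη
  have hfX : ∀ x, ‖f x‖ ≤ X := fun x => by
    rw [hf, Complex.norm_real]
    exact hX x
  have hcoef : ∀ k : ℤ, ‖fourierC f k‖ * |(k : ℝ)| ^ 20 ≤ K := fun k =>
    hs.norm_fourierC_mul_le k hfper
  have hη0 : ∀ x, |s x| ≤ η := fun x => by
    have := norm_le_of_norm_fourierC_le hs.continuous hfper (fun k => by
      simpa using norm_fourierC_mul_pow_le_weight hfX hcoef hM1 (j := 0) (by norm_num) k) x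
    rwa [Complex.norm_real] at this
  have hη1 : ∀ x, |deriv s x| ≤ η := fun x => by
    have := norm_le_of_norm_fourierC_le hfd'.continuous hfper.deriv' (fun k => by
      rw [fourierC_deriv hfd hfd'.continuous hfper, norm_mul, norm_mul, Complex.norm_I,
        Complex.norm_intCast, mul_one]
      simpa using norm_fourierC_mul_pow_le_weight hfX hcoef hM1 (j := 1) (by norm_num) k) x
    rwa [hd, Complex.norm_real] at this
  have hη2 : ∀ x, |deriv (deriv s) x| ≤ η := fun x => by
    have := norm_le_of_norm_fourierC_le hfc'' hfper.deriv'.deriv' (fun k => by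
      rw [fourierC_deriv hfd' hfc'' hfper.deriv', fourierC_deriv hfd hfd'.continuous hfper,
        norm_mul, norm_mul, norm_mul, norm_mul, Complex.norm_I,
        Complex.norm_intCast, mul_one, ← mul_assoc, ← pow_two]
      exact norm_fourierC_mul_pow_le_weight hfX hcoef hM1 (j := 2) (by norm_num) k) x
    rwa [hd', Complex.norm_real] at this
  have hη3 : ∀ x y, |deriv s x - deriv s y| ≤ η * |x - y| := fun x y =>
    convex_univ.norm_image_sub_le_of_norm_deriv_le (fun z _ => hsd' z) (fun z _ => hη2 z)
      (mem_univ y) (mem_univ x)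
  have hηM : η ≤ W * (1 + K) / M ^ 10 := by
    have h1 : M ^ 4 * X ≤ 1 / M ^ 10 := by
      rw [le_div_iff₀ (by positivity)]
      calc _ = (M : ℝ) ^ 14 * X := by ring
        _ ≤ 1 := hmin
    have h2 : K / (M : ℝ) ^ 16 ≤ K / M ^ 10 := by
      gcongr
      norm_num
    have h3 : W * (1 + K) / (M : ℝ) ^ 10 = (1 / M ^ 10 + K / M ^ 10) * W := by ring
    rw [h3, hη]
    gcongr
  have hηpos : 0 ≤ η := (abs_nonneg _).trans (hη0 0)
  have hMη : 100 * M * η ≤ 1 := by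
    calc 100 * M * η ≤ 100 * M * (W * (1 + K) / M ^ 10) := by gcongr
      _ = 100 * (W * (1 + K)) / M ^ 9 := by field_simp
      _ ≤ M / M ^ 9 := by gcongr; linarith
      _ ≤ 1 := by
        rw [div_le_one (by positivity)]
        exact le_self_pow₀ hM1 (by norm_num)
  have hlr : lowModeRatio * (8 * W) = 1 := by
    rw [lowModeRatio, ← hW]; field_simp
  have hlr0 : 0 ≤ lowModeRatio := by
    unfold lowModeRatio; positivity
  set B := 4 * (lowModeRatio * X) + (91 * M ^ 4 * η ^ 2 + K / M ^ 18) with hB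
  have hBcoef : ∀ k, ‖fourierC f k‖ ≤ B * weight k := by
    intro k
    have t1 : 0 ≤ K / (M : ℝ) ^ 18 := by positivity
    have t2 : 0 ≤ 91 * (M : ℝ) ^ 4 * η ^ 2 := by positivity
    have t3 : 0 ≤ lowModeRatio * X := by positivity
    rcases eq_or_ne k 0 with rfl | hk
    · rw [weight_zero, mul_one]
      have := hlow X hX 0 (by norm_num)
      linarith
    rw [weight_of_ne hk, ← sq_abs, mul_one_div, le_div_iff₀ (by
      have := one_le_abs_intCast hk; positivity)]
    rcases le_or_gt |(k : ℝ)| 2 with h2 | h2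
    · have := hlow X hX k h2
      have h4 : |(k : ℝ)| ^ 2 ≤ 2 ^ 2 := by gcongr
      have : ‖fourierC f k‖ * |(k : ℝ)| ^ 2 ≤ lowModeRatio * X * 2 ^ 2 := by gcongr
      linarith
    have h3 : 3 ≤ |(k : ℝ)| := by
      have : (2 : ℤ) < |k| := by exact_mod_cast h2
      exact_mod_cast (by omega : (3 : ℤ) ≤ |k|)
    rcases le_total |(k : ℝ)| M with hkM | hkM
    · have := hpol.norm_fourierC_le hsd hsd'.continuous hper hη0 hη1 hη3 h3
        (le_trans (by gcongr) hMη)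
      calc _ ≤ 91 * |(k : ℝ)| ^ 2 * η ^ 2 * |(k : ℝ)| ^ 2 := by gcongr
        _ = 91 * |(k : ℝ)| ^ 4 * η ^ 2 := by ring
        _ ≤ 91 * M ^ 4 * η ^ 2 := by gcongr
        _ ≤ B := by linarith
    · have : ‖fourierC f k‖ * |(k : ℝ)| ^ 2 ≤ K / M ^ 18 := by
        rw [le_div_iff₀ (by positivity)]
        calc _ ≤ ‖fourierC f k‖ * |(k : ℝ)| ^ 2 * |(k : ℝ)| ^ 18 := by gcongr
          _ = ‖fourierC f k‖ * |(k : ℝ)| ^ 20 := by ring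
          _ ≤ K := hcoef k
      linarith
  have hXB : X ≤ B * W := csSup_le (range_nonempty _) (by
    rintro _ ⟨x, rfl⟩
    have := norm_le_of_norm_fourierC_le hs.continuous hfper hBcoef x
    rwa [Complex.norm_real] at this)
  have hXD : X ≤ D / M ^ 16 := by
    have e1 : 4 * (lowModeRatio * X) * W = X / 2 := by linear_combination X / 2 * hlr
    have e2 : 91 * M ^ 4 * η ^ 2 ≤ 91 * M ^ 4 * (W * (1 + K) / M ^ 10) ^ 2 := by gcongr
    have e3 : 91 * (M : ℝ) ^ 4 * (W * (1 + K) / M ^ 10) ^ 2 = 91 * (W * (1 + K)) ^ 2 / M ^ 16 := by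
      field_simp
    have e4 : K / (M : ℝ) ^ 18 ≤ K / M ^ 16 := by
      gcongr
      norm_num
    have e5 : D / (M : ℝ) ^ 16 = 2 * (91 * (W * (1 + K)) ^ 2 / M ^ 16 + K / M ^ 16) * W := by
      rw [hD]; ring
    have e6 : (91 * M ^ 4 * η ^ 2 + K / M ^ 18) * W ≤
        (91 * (W * (1 + K)) ^ 2 / M ^ 16 + K / M ^ 16) * W := by
      gcongr
      exact e2.trans_eq e3
    rw [e5]
    have e7 : B * W = X / 2 + (91 * M ^ 4 * η ^ 2 + K / M ^ 18) * W := by rw [hB, add_mul, e1]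
    linarith
  have hcontra : (M : ℝ) ^ 16 < D * 2 ^ 14 * M ^ 14 := by
    have h1 : ((M + 1 : ℕ) : ℝ) ^ 14 * X ≤ (2 * M) ^ 14 * (D / M ^ 16) := by
      gcongr
      push_cast
      linarith
    have h2 : (1 : ℝ) < (2 * M) ^ 14 * (D / M ^ 16) := hspec.trans_le h1
    rw [← mul_div_assoc, lt_div_iff₀ (by positivity)] at h2
    calc (M : ℝ) ^ 16 = 1 * M ^ 16 := (one_mul _).symm
      _ < _ := h2
      _ = _ := by ring
  have : D * 2 ^ 14 * (M : ℝ) ^ 14 ≤ M ^ 16 := by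
    calc D * 2 ^ 14 * (M : ℝ) ^ 14 ≤ (M : ℝ) * (M : ℝ) ^ 14 := by gcongr; linarith
      _ = (M : ℝ) ^ 15 := by ring
      _ ≤ (M : ℝ) ^ 16 := pow_le_pow_right₀ hM1 (by norm_num)
  linarith


/-- The functions of the family `F` and their derivatives up to order `m` are uniformly bounded. -/
def UniformlyBounded {ι E : Type*} [NormedAddCommGroup E] [NormedSpace ℝ E] (m : ℕ)
    (F : ι → ℝ → E) : Prop :=
  ∃ C, ∀ i, HasBoundedDerivs m C (F i)

namespace UniformlyBounded

section

variable {ι E G : Type*} [NormedAddCommGroup E] [NormedSpace ℝ E] [NormedAddCommGroup G]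
  [NormedSpace ℝ G] {m : ℕ} {F F' : ι → ℝ → E}

theorem of_succ (h : UniformlyBounded (m + 1) F) : UniformlyBounded m F :=
  h.imp fun _ h i => (h i).of_succ

theorem bounded (h : UniformlyBounded m F) : ∃ C, ∀ i x, ‖F i x‖ ≤ C :=
  h.imp fun _ h i => (h i).norm_le

theorem continuous (h : UniformlyBounded m F) (i : ι) : Continuous (F i) :=
  (h.choose_spec i).continuous

theorem differentiable (h : UniformlyBounded (m + 1) F) (i : ι) : Differentiable ℝ (F i) :=
  (h.choose_spec i).1

theorem deriv (h : UniformlyBounded (m + 1) F) : UniformlyBounded m fun i => deriv (F i) :=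
  h.imp fun _ h i => (h i).2.2

theorem succ (hd : ∀ i, Differentiable ℝ (F i)) (hb : ∃ C, ∀ i x, ‖F i x‖ ≤ C)
    (h : UniformlyBounded m fun i => _root_.deriv (F i)) : UniformlyBounded (m + 1) F := by
  obtain ⟨C, hC⟩ := hb
  obtain ⟨C', hC'⟩ := h
  exact ⟨max C C', fun i => ⟨hd i, fun x => (hC i x).trans (le_max_left _ _),
    (hC' i).mono (le_max_right _ _)⟩⟩

theorem succ' {f' : ι → ℝ → E} (hd : ∀ i x, HasDerivAt (F i) (f' i x) x)
    (hb : ∃ C, ∀ i x, ‖F i x‖ ≤ C) (h : UniformlyBounded m f') : UniformlyBounded (m + 1) F := by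
  refine succ (fun i x => (hd i x).differentiableAt) hb ?_
  have : (fun i => _root_.deriv (F i)) = f' := funext fun i => funext fun x => (hd i x).deriv
  rwa [this]

theorem const {c : ι → E} {C : ℝ} (hc : ∀ i, ‖c i‖ ≤ C) :
    UniformlyBounded m fun i (_ : ℝ) => c i := by
  induction m generalizing c C with
  | zero => exact ⟨C, fun i => ⟨continuous_const, fun _ => hc i⟩⟩
  | succ m ih =>
    exact succ' (fun i x => hasDerivAt_const x (c i)) ⟨C, fun i _ => hc i⟩
      (ih (C := 0) fun i => by simp)

theorem add (h : UniformlyBounded m F) (h' : UniformlyBounded m F') :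
    UniformlyBounded m fun i x => F i x + F' i x := by
  have hb : ∃ C, ∀ i x, ‖F i x + F' i x‖ ≤ C := by
    obtain ⟨C, hC⟩ := h.bounded
    obtain ⟨C', hC'⟩ := h'.bounded
    exact ⟨C + C', fun i x => (norm_add_le _ _).trans (add_le_add (hC i x) (hC' i x))⟩
  induction m generalizing F F' with
  | zero => exact hb.imp fun _ hC i => ⟨(h.continuous i).add (h'.continuous i), hC i⟩
  | succ m ih =>
    refine succ' (fun i x => (h.differentiable i x).hasDerivAt.add
      (h'.differentiable i x).hasDerivAt) hb (ih h.deriv h'.deriv ?_)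
    obtain ⟨C, hC⟩ := h.deriv.bounded
    obtain ⟨C', hC'⟩ := h'.deriv.bounded
    exact ⟨C + C', fun i x => (norm_add_le _ _).trans (add_le_add (hC i x) (hC' i x))⟩

theorem clm_comp (T : E →L[ℝ] G) (h : UniformlyBounded m F) :
    UniformlyBounded m fun i x => T (F i x) := by
  have hb : ∀ {F : ι → ℝ → E}, (∃ C, ∀ i x, ‖F i x‖ ≤ C) → ∃ C, ∀ i x, ‖T (F i x)‖ ≤ C :=
    fun ⟨C, hC⟩ => ⟨‖T‖ * C, fun i x => (T.le_opNorm _).trans (by gcongr; exact hC i x)⟩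
  induction m generalizing F with
  | zero => exact (hb h.bounded).imp fun _ hC i => ⟨T.continuous.comp (h.continuous i), hC i⟩
  | succ m ih =>
    exact succ' (fun i x => T.hasFDerivAt.comp_hasDerivAt x (h.differentiable i x).hasDerivAt)
      (hb h.bounded) (ih h.deriv)

theorem of_contDiff {f : ι → ℝ → E} {C : ℝ} (hf : ∀ i, ContDiff ℝ m (f i))
    (hC : ∀ i, ∀ j ≤ m, ∀ x, ‖iteratedDeriv j (f i) x‖ ≤ C) : UniformlyBounded m f := by
  induction m generalizing f with
  | zero =>
    exact ⟨C, fun i => ⟨(hf i).continuous, fun x => by simpa using hC i 0 le_rfl x⟩⟩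
  | succ m ih =>
    have h0 : ∀ i, ContDiff ℝ ((m : WithTop ℕ∞) + 1) (f i) := fun i => by exact_mod_cast hf i
    have h1 := fun i => contDiff_succ_iff_deriv.1 (h0 i)
    refine succ (fun i => (h1 i).1) ⟨C, fun i x => by simpa using hC i 0 (by omega) x⟩
      (ih (fun i => (h1 i).2.2) fun i j hj x => ?_)
    rw [← iteratedDeriv_succ']
    exact hC i (j + 1) (by omega) x

end

section

variable {ι 𝔸 : Type*} {m : ℕ}

theorem mul [NormedRing 𝔸] [NormedAlgebra ℝ 𝔸] {F F' : ι → ℝ → 𝔸} (h : UniformlyBounded m F)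
    (h' : UniformlyBounded m F') : UniformlyBounded m fun i x => F i x * F' i x := by
  have hb : ∃ C, ∀ i x, ‖F i x * F' i x‖ ≤ C := by
    obtain ⟨C, hC⟩ := h.bounded
    obtain ⟨C', hC'⟩ := h'.bounded
    exact ⟨C * C', fun i x => (norm_mul_le _ _).trans (mul_le_mul (hC i x) (hC' i x) (norm_nonneg _)
      ((norm_nonneg _).trans (hC i x)))⟩
  induction m generalizing F F' with
  | zero => exact hb.imp fun _ hC i => ⟨(h.continuous i).mul (h'.continuous i), hC i⟩
  | succ m ih =>
    have hb' : ∀ {G G' : ι → ℝ → 𝔸}, UniformlyBounded m G → UniformlyBounded m G' →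
        ∃ C, ∀ i x, ‖G i x * G' i x‖ ≤ C := fun h h' => by
      obtain ⟨C, hC⟩ := h.bounded
      obtain ⟨C', hC'⟩ := h'.bounded
      exact ⟨C * C', fun i x => (norm_mul_le _ _).trans (mul_le_mul (hC i x) (hC' i x)
        (norm_nonneg _) ((norm_nonneg _).trans (hC i x)))⟩
    exact succ' (fun i x => (h.differentiable i x).hasDerivAt.mul
      (h'.differentiable i x).hasDerivAt) hb ((ih h.deriv h'.of_succ (hb' h.deriv h'.of_succ)).add
      (ih h.of_succ h'.deriv (hb' h.of_succ h'.deriv)))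

theorem inv [NontriviallyNormedField 𝔸] [NormedAlgebra ℝ 𝔸] {F : ι → ℝ → 𝔸} {c : ℝ} (hc : 0 < c)
    (hF : ∀ i x, c ≤ ‖F i x‖) (h : UniformlyBounded m F) :
    UniformlyBounded m fun i x => (F i x)⁻¹ := by
  have hne : ∀ i x, F i x ≠ 0 := fun i x h0 => by
    have := hF i x
    rw [h0, norm_zero] at this
    linarith
  have hb : ∀ i x, ‖(F i x)⁻¹‖ ≤ c⁻¹ := fun i x => by
    rw [norm_inv]
    exact inv_anti₀ hc (hF i x)
  induction m with
  | zero => exact ⟨c⁻¹, fun i => ⟨(h.continuous i).inv₀ (hne i), hb i⟩⟩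
  | succ m ih =>
    refine succ' (f' := fun i x => (-1) * _root_.deriv (F i) x * ((F i x)⁻¹ * (F i x)⁻¹))
      (fun i x => ?_) ⟨_, hb⟩ (((const (c := fun _ : ι => (-1 : 𝔸)) (C := 1) (fun i => by
        simp)).mul h.deriv).mul ((ih h.of_succ).mul (ih h.of_succ)))
    have := ((h.differentiable i x).hasDerivAt).inv (hne i x)
    have e : (-1) * _root_.deriv (F i) x * ((F i x)⁻¹ * (F i x)⁻¹) =
        -_root_.deriv (F i) x / F i x ^ 2 := by
      rw [neg_one_mul, div_eq_mul_inv, pow_two, mul_inv]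
    simp only [e]
    exact this

theorem comp {F h : ι → ℝ → ℝ} (hF : UniformlyBounded (m + 1) F)
    (hd : ∀ i, Differentiable ℝ (h i)) (hh : UniformlyBounded m fun i => _root_.deriv (h i)) :
    UniformlyBounded (m + 1) fun i x => F i (h i x) := by
  have hder : ∀ {F : ι → ℝ → ℝ}, (∀ i, Differentiable ℝ (F i)) → ∀ i x,
      HasDerivAt (fun x => F i (h i x)) (_root_.deriv (F i) (h i x) * _root_.deriv (h i) x) x :=
    fun hF i x => (hF i (h i x)).hasDerivAt.comp x (hd i x).hasDerivAt
  induction m generalizing F with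
  | zero =>
    obtain ⟨C, hC⟩ := hF
    refine succ' (hder fun i => (hC i).1) ⟨C, fun i x => (hC i).norm_le _⟩ (mul ⟨C, fun i =>
      ⟨((hC i).2.2.continuous).comp (hd i).continuous, fun x => (hC i).2.2.norm_le _⟩⟩ hh)
  | succ m ih =>
    obtain ⟨C, hC⟩ := hF.bounded
    exact succ' (hder hF.differentiable) ⟨C, fun i x => hC i _⟩ ((ih hF.deriv hh.of_succ).mul hh)

theorem deriv_inverse {h g : ι → ℝ → ℝ} {c : ℝ} (hc : 0 < c) (hh : UniformlyBounded m
    fun i => _root_.deriv (h i)) (hpos : ∀ i x, c ≤ _root_.deriv (h i) x)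
    (hg : ∀ i x, HasDerivAt (g i) (_root_.deriv (h i) (g i x))⁻¹ x) :
    UniformlyBounded m fun i => _root_.deriv (g i) := by
  have hinv : UniformlyBounded m fun i x => (_root_.deriv (h i) x)⁻¹ :=
    inv hc (fun i x => (hpos i x).trans (le_abs_self _)) hh
  have hd : ∀ i, Differentiable ℝ (g i) := fun i x => (hg i x).differentiableAt
  have e : (fun i => _root_.deriv (g i)) = fun i x => (_root_.deriv (h i) (g i x))⁻¹ :=
    funext fun i => funext fun x => (hg i x).deriv
  induction m with
  | zero =>
    obtain ⟨C, hC⟩ := hinv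
    rw [e]
    exact ⟨C, fun i => ⟨(hC i).1.comp (hd i).continuous, fun x => (hC i).2 _⟩⟩
  | succ m ih =>
    have h1 := ih hh.of_succ hinv.of_succ
    rw [e]
    exact hinv.comp hd h1

theorem clog {F : ι → ℝ → ℂ} {c : ℝ} (hc : 0 < c) (hF : ∀ i x, c ≤ ‖F i x‖)
    (hslit : ∀ i x, F i x ∈ Complex.slitPlane) (hb : ∃ C, ∀ i x, ‖Complex.log (F i x)‖ ≤ C)
    (h : UniformlyBounded m F) : UniformlyBounded m fun i x => Complex.log (F i x) := by
  cases m with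
  | zero => exact hb.imp fun C hC i => ⟨(h.continuous i).clog (hslit i), hC i⟩
  | succ m =>
    exact succ' (fun i x => (h.differentiable i x).hasDerivAt.clog_real (hslit i x)) hb
      (by simpa only [div_eq_mul_inv] using h.deriv.mul (inv hc hF h.of_succ))

end

end UniformlyBounded


/-- The quadratic polynomial `v₀ + v₁ x + v₂ y + v₃ (x² - y²) + 2 v₄ x y`. -/
def quadPoly (v : Fin 5 → ℝ) (z : ℂ) : ℝ :=
  v 0 + v 1 * z.re + v 2 * z.im + v 3 * (z.re ^ 2 - z.im ^ 2) + v 4 * (2 * z.re * z.im)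

/-- A small perturbation of the equation of the unit circle by a quadratic polynomial is, up to a
factor, the equation of the preimage of the unit circle under an affine map close to the identity. -/
theorem exists_affine_of_quadPoly {δ : ℝ} (hδ : 0 < δ) : ∃ ε : ℝ, 0 < ε ∧ ∀ v : Fin 5 → ℝ,
    ‖v‖ < ε → ∃ A B D : ℂ, ∃ R : ℝ, R ≠ 0 ∧ ‖A - 1‖ < δ ∧ ‖B‖ < δ ∧ ‖D‖ < δ ∧ ∀ z : ℂ,
      ‖z‖ ^ 2 - 1 + quadPoly v z =
        R * (‖A * z + B * (starRingEnd ℂ) z + D‖ ^ 2 - 1) := by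
  let P : (Fin 5 → ℝ) → ℝ := fun v => 1 + v 3
  let Q : (Fin 5 → ℝ) → ℝ := fun v => 1 - v 3 - v 4 ^ 2 / P v
  let G : (Fin 5 → ℝ) → ℝ := fun v => v 2 / 2 - v 4 * (v 1 / 2) / P v
  let R : (Fin 5 → ℝ) → ℝ := fun v => 1 - v 0 + (v 1 / 2) ^ 2 / P v + G v ^ 2 / Q v
  let α : (Fin 5 → ℝ) → ℝ := fun v => √(P v / R v)
  let β : (Fin 5 → ℝ) → ℝ := fun v => α v * (v 4 / P v)
  let τ : (Fin 5 → ℝ) → ℝ := fun v => α v * (v 1 / 2 / P v)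
  let μ : (Fin 5 → ℝ) → ℝ := fun v => √(Q v / R v)
  let σ : (Fin 5 → ℝ) → ℝ := fun v => μ v * (G v / Q v)
  have hP0 : P 0 = 1 := by simp [P]
  have hQ0 : Q 0 = 1 := by simp [Q]
  have hR0 : R 0 = 1 := by simp [R, G]
  have cv : ∀ i, ContinuousAt (fun v : Fin 5 → ℝ => v i) 0 := fun i =>
    (continuous_apply i).continuousAt
  have nP : P 0 ≠ 0 := by rw [hP0]; norm_num
  have nQ : Q 0 ≠ 0 := by rw [hQ0]; norm_num
  have nR : R 0 ≠ 0 := by rw [hR0]; norm_num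
  have cP : ContinuousAt P 0 := continuousAt_const.add (cv 3)
  have cQ : ContinuousAt Q 0 := (continuousAt_const.sub (cv 3)).sub (((cv 4).pow 2).div cP nP)
  have cG : ContinuousAt G 0 :=
    ((cv 2).div_const 2).sub (((cv 4).mul ((cv 1).div_const 2)).div cP nP)
  have cR : ContinuousAt R 0 := ((continuousAt_const.sub (cv 0)).add
    ((((cv 1).div_const 2).pow 2).div cP nP)).add ((cG.pow 2).div cQ nQ)
  have cα : ContinuousAt α 0 := (cP.div cR nR).sqrt
  have cβ : ContinuousAt β 0 := cα.mul ((cv 4).div cP nP)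
  have cτ : ContinuousAt τ 0 := cα.mul (((cv 1).div_const 2).div cP nP)
  have cμ : ContinuousAt μ 0 := (cQ.div cR nR).sqrt
  have cσ : ContinuousAt σ 0 := cμ.mul (cG.div cQ nQ)
  let A : (Fin 5 → ℝ) → ℂ := fun v => (((α v + μ v) / 2 : ℝ) : ℂ) - ((β v / 2 : ℝ) : ℂ) * Complex.I
  let B : (Fin 5 → ℝ) → ℂ := fun v => (((α v - μ v) / 2 : ℝ) : ℂ) + ((β v / 2 : ℝ) : ℂ) * Complex.I
  let D : (Fin 5 → ℝ) → ℂ := fun v => (τ v : ℂ) + (σ v : ℂ) * Complex.I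
  have cA : ContinuousAt (fun v => ‖A v - 1‖) 0 := by fun_prop
  have cB : ContinuousAt (fun v => ‖B v‖) 0 := by fun_prop
  have cD : ContinuousAt (fun v => ‖D v‖) 0 := by fun_prop
  have hα0 : α 0 = 1 := by simp [α, hP0, hR0]
  have hμ0 : μ 0 = 1 := by simp [μ, hQ0, hR0]
  have hβ0 : β 0 = 0 := by simp [β]
  have hτ0 : τ 0 = 0 := by simp [τ]
  have hσ0 : σ 0 = 0 := by simp [σ, G]
  have hA0 : ‖A 0 - 1‖ < δ := by simpa [A, hα0, hμ0, hβ0] using hδ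
  have hB0 : ‖B 0‖ < δ := by simpa [B, hα0, hμ0, hβ0] using hδ
  have hD0 : ‖D 0‖ < δ := by simpa [D, hτ0, hσ0] using hδ
  have hev : ∀ᶠ v in 𝓝 (0 : Fin 5 → ℝ), (0 < P v ∧ 0 < Q v ∧ 0 < R v) ∧
      ‖A v - 1‖ < δ ∧ ‖B v‖ < δ ∧ ‖D v‖ < δ :=
    (((cP.eventually (lt_mem_nhds (by rw [hP0]; norm_num))).and
      ((cQ.eventually (lt_mem_nhds (by rw [hQ0]; norm_num))).and
        (cR.eventually (lt_mem_nhds (by rw [hR0]; norm_num)))))).and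
    ((cA.eventually (gt_mem_nhds hA0)).and ((cB.eventually (gt_mem_nhds hB0)).and
      (cD.eventually (gt_mem_nhds hD0))))
  obtain ⟨ε, hε, hball⟩ := Metric.eventually_nhds_iff.1 hev
  refine ⟨ε, hε, fun v hv => ?_⟩
  obtain ⟨⟨hP, hQ, hR⟩, hA, hB, hD⟩ := hball (by rwa [dist_zero_right] : dist v 0 < ε)
  refine ⟨A v, B v, D v, R v, hR.ne', hA, hB, hD, fun z => ?_⟩
  obtain ⟨x, y⟩ := z
  have hα : α v ^ 2 = P v / R v := Real.sq_sqrt (by positivity)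
  have hμ : μ v ^ 2 = Q v / R v := Real.sq_sqrt (by positivity)
  have hre : (A v * ⟨x, y⟩ + B v * (starRingEnd ℂ) ⟨x, y⟩ + D v).re =
      α v * (x + v 4 / P v * y + v 1 / 2 / P v) := by
    simp [A, B, D, β, τ]
    ring
  have him : (A v * ⟨x, y⟩ + B v * (starRingEnd ℂ) ⟨x, y⟩ + D v).im =
      μ v * (y + G v / Q v) := by
    simp [A, B, D, σ]
    ring
  rw [Complex.sq_norm, Complex.sq_norm, Complex.normSq_apply, Complex.normSq_apply, hre, him]
  have e : R v * (α v * (x + v 4 / P v * y + v 1 / 2 / P v) *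
      (α v * (x + v 4 / P v * y + v 1 / 2 / P v)) +
      μ v * (y + G v / Q v) * (μ v * (y + G v / Q v)) - 1) =
      P v * (x + v 4 / P v * y + v 1 / 2 / P v) ^ 2 + Q v * (y + G v / Q v) ^ 2 - R v := by
    have e1 : R v * α v ^ 2 = P v := by rw [hα]; field_simp
    have e2 : R v * μ v ^ 2 = Q v := by rw [hμ]; field_simp
    linear_combination (x + v 4 / P v * y + v 1 / 2 / P v) ^ 2 * e1 + (y + G v / Q v) ^ 2 * e2
  rw [e]
  have e3 : Q v * (y + G v / Q v) ^ 2 = Q v * y ^ 2 + 2 * G v * y + G v ^ 2 / Q v := by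
    field_simp
    ring
  have e4 : P v * (x + v 4 / P v * y + v 1 / 2 / P v) ^ 2 =
      P v * x ^ 2 + v 4 ^ 2 / P v * y ^ 2 + (v 1 / 2) ^ 2 / P v + 2 * v 4 * x * y + v 1 * x +
        2 * (v 4 * (v 1 / 2) / P v) * y := by
    field_simp
    ring
  rw [e3, e4]
  simp only [quadPoly, R, Q, G, P]
  ring


/-- The monomials spanning the polynomials `quadPoly v`; their restrictions to the unit circle are
`1`, `cos θ`, `sin θ`, `cos 2θ` and `sin 2θ`. -/
def quadMonomial (i : Fin 5) (z : ℂ) : ℝ :=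
  (![1, z.re, z.im, z.re ^ 2 - z.im ^ 2, 2 * z.re * z.im] : Fin 5 → ℝ) i

theorem quadPoly_eq_sum (v : Fin 5 → ℝ) (z : ℂ) :
    quadPoly v z = ∑ i, v i * quadMonomial i z := by
  simp [quadPoly, quadMonomial, Fin.sum_univ_five]

theorem quadPoly_add (v w : Fin 5 → ℝ) (z : ℂ) :
    quadPoly (v + w) z = quadPoly v z + quadPoly w z := by
  simp [quadPoly]; ring

theorem quadPoly_smul (c : ℝ) (v : Fin 5 → ℝ) (z : ℂ) :
    quadPoly (c • v) z = c * quadPoly v z := by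
  simp [quadPoly]; ring

theorem continuous_quadMonomial (i : Fin 5) : Continuous (quadMonomial i) := by
  unfold quadMonomial
  fin_cases i <;> simp <;> fun_prop

theorem continuous_quadPoly (v : Fin 5 → ℝ) : Continuous (quadPoly v) := by
  unfold quadPoly; fun_prop

/-- The curve with polar equation `r = 1 + ν`. -/
def polar (ν : ℝ → ℝ) (θ : ℝ) : ℂ := ((1 + ν θ : ℝ) : ℂ) * Complex.exp (θ * Complex.I)

theorem continuous_polar {ν : ℝ → ℝ} (h : Continuous ν) : Continuous (polar ν) := by
  unfold polar; fun_prop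

theorem abs_quadMonomial_le {z : ℂ} (hz : ‖z‖ = 1) (i : Fin 5) : |quadMonomial i z| ≤ 2 := by
  have h1 : |z.re| ≤ 1 := hz ▸ Complex.abs_re_le_norm z
  have h2 : |z.im| ≤ 1 := hz ▸ Complex.abs_im_le_norm z
  have := abs_le.1 h1
  have := abs_le.1 h2
  fin_cases i
  · simp [quadMonomial]
  · show |z.re| ≤ 2
    linarith
  · show |z.im| ≤ 2
    linarith
  · show |z.re ^ 2 - z.im ^ 2| ≤ 2
    rw [abs_le]
    constructor <;> nlinarith
  · show |2 * z.re * z.im| ≤ 2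
    rw [abs_mul, abs_mul, abs_two]
    have := mul_le_mul h1 h2 (abs_nonneg _) zero_le_one
    linarith

theorem abs_quadMonomial_sub_le {η a : ℝ} (hη : η ≤ 1) (ha : |a| ≤ η) {z : ℂ} (hz : ‖z‖ = 1)
    (i : Fin 5) : |quadMonomial i (((1 + a : ℝ) : ℂ) * z) - quadMonomial i z| ≤ 6 * η := by
  have h2 : |(1 + a) ^ 2 - 1| ≤ 3 * η := by
    have : (1 + a) ^ 2 - 1 = a * (2 + a) := by ring
    rw [this, abs_mul]
    have h3 : |2 + a| ≤ 3 := by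
      have := abs_le.1 ha
      exact abs_le.2 ⟨by linarith, by linarith⟩
    nlinarith [abs_nonneg a]
  obtain ⟨c, hc, hcη⟩ : ∃ c : ℝ, quadMonomial i (((1 + a : ℝ) : ℂ) * z) - quadMonomial i z =
      c * quadMonomial i z ∧ |c| ≤ 3 * η := by
    have h0 := abs_nonneg a
    unfold quadMonomial
    fin_cases i
    · exact ⟨0, by simp, by simp; linarith⟩
    · exact ⟨a, by simp; ring, by linarith⟩
    · exact ⟨a, by simp; ring, by linarith⟩
    · exact ⟨_, by simp; ring, h2⟩
    · exact ⟨_, by simp; ring, h2⟩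
  rw [hc, abs_mul]
  calc _ ≤ 3 * η * 2 := mul_le_mul hcη (abs_quadMonomial_le hz i) (abs_nonneg _)
        ((abs_nonneg _).trans hcη)
    _ = _ := by ring

theorem abs_quadPoly_sub_le {η a : ℝ} (hη : η ≤ 1) (ha : |a| ≤ η) {z : ℂ} (hz : ‖z‖ = 1)
    (v : Fin 5 → ℝ) : |quadPoly v (((1 + a : ℝ) : ℂ) * z) - quadPoly v z| ≤ 30 * η * ‖v‖ := by
  rw [quadPoly_eq_sum, quadPoly_eq_sum, ← Finset.sum_sub_distrib]
  refine (Finset.abs_sum_le_sum_abs _ _).trans ?_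
  have : ∀ i ∈ Finset.univ, |v i * quadMonomial i (((1 + a : ℝ) : ℂ) * z) - v i * quadMonomial i z|
      ≤ ‖v‖ * (6 * η) := fun i _ => by
    rw [← mul_sub, abs_mul]
    exact mul_le_mul (norm_le_pi_norm v i) (abs_quadMonomial_sub_le hη ha hz i) (abs_nonneg _)
      (norm_nonneg _)
  refine (Finset.sum_le_sum this).trans_eq ?_
  simp
  ring

theorem eq_zero_of_quadPoly_circle {v : Fin 5 → ℝ}
    (h : ∀ θ : ℝ, quadPoly v (Complex.exp (θ * Complex.I)) = 0) : v = 0 := by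
  have h' : ∀ θ : ℝ, v 0 + v 1 * Real.cos θ + v 2 * Real.sin θ +
      v 3 * (Real.cos θ ^ 2 - Real.sin θ ^ 2) + v 4 * (2 * Real.cos θ * Real.sin θ) = 0 := by
    intro θ
    have := h θ
    rwa [quadPoly, Complex.exp_ofReal_mul_I_re, Complex.exp_ofReal_mul_I_im] at this
  have a1 := h' 0
  have a2 := h' Real.pi
  have a3 := h' (Real.pi / 2)
  have a4 := h' (-(Real.pi / 2))
  have a5 := h' (Real.pi / 4)
  simp only [Real.cos_neg, Real.sin_neg, Real.cos_zero, Real.sin_zero, Real.cos_pi, Real.sin_pi,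
    Real.cos_pi_div_two, Real.sin_pi_div_two, Real.cos_pi_div_four, Real.sin_pi_div_four]
    at a1 a2 a3 a4 a5
  have b1 : v 1 = 0 := by linarith
  have b2 : v 2 = 0 := by linarith
  have b0 : v 0 = 0 := by linarith
  have b3 : v 3 = 0 := by linarith
  have b4 : v 4 = 0 := by
    have hs : √2 * √2 = (2 : ℝ) := Real.mul_self_sqrt (by norm_num)
    rw [b1, b2, b3, b0] at a5
    linear_combination a5 - v 4 / 2 * hs
  funext i
  fin_cases i <;> assumption

/-- The moments of `quadPoly v` along a curve. -/
def moments (γ : ℝ → ℂ) (hγ : Continuous γ) : (Fin 5 → ℝ) →ₗ[ℝ] (Fin 5 → ℝ) where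
  toFun v i := ∫ θ in (0 : ℝ)..(2 * Real.pi),
    quadPoly v (γ θ) * quadMonomial i (Complex.exp (θ * Complex.I))
  map_add' v w := by
    funext i
    have hc : Continuous fun θ : ℝ => quadMonomial i (Complex.exp (θ * Complex.I)) :=
      (continuous_quadMonomial i).comp (by fun_prop)
    rw [Pi.add_apply, ← intervalIntegral.integral_add]
    · simp only [quadPoly_add, add_mul]
    · exact (((continuous_quadPoly v).comp hγ).mul hc).intervalIntegrable _ _
    · exact (((continuous_quadPoly w).comp hγ).mul hc).intervalIntegrable _ _
  map_smul' c v := by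
    funext i
    rw [Pi.smul_apply, RingHom.id_apply, smul_eq_mul, ← intervalIntegral.integral_const_mul]
    simp only [quadPoly_smul, mul_assoc]

theorem continuous_exp_mul_I : Continuous fun θ : ℝ => Complex.exp (θ * Complex.I) := by fun_prop

theorem ker_moments_circle : LinearMap.ker (moments _ continuous_exp_mul_I) = ⊥ := by
  rw [LinearMap.ker_eq_bot']
  intro v hv
  have h1 : ∫ θ in (0 : ℝ)..(2 * Real.pi), quadPoly v (Complex.exp (θ * Complex.I)) ^ 2 = 0 := by
    have e : ∀ θ : ℝ, quadPoly v (Complex.exp (θ * Complex.I)) ^ 2 = ∑ i, v i *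
        (quadPoly v (Complex.exp (θ * Complex.I)) *
          quadMonomial i (Complex.exp (θ * Complex.I))) := by
      intro θ
      rw [pow_two]
      nth_rewrite 2 [quadPoly_eq_sum]
      rw [Finset.mul_sum]
      exact Finset.sum_congr rfl fun i _ => by ring
    simp only [e]
    rw [intervalIntegral.integral_finsetSum]
    · refine Finset.sum_eq_zero fun i _ => ?_
      rw [intervalIntegral.integral_const_mul]
      have : ∫ θ in (0 : ℝ)..(2 * Real.pi), quadPoly v (Complex.exp (θ * Complex.I)) *
        quadMonomial i (Complex.exp (θ * Complex.I)) = 0 := congrFun hv i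
      rw [this, mul_zero]
    · intro i _
      exact (continuous_const.mul (((continuous_quadPoly v).comp continuous_exp_mul_I).mul
        ((continuous_quadMonomial i).comp continuous_exp_mul_I))).intervalIntegrable _ _
  have hc : Continuous fun θ : ℝ => quadPoly v (Complex.exp (θ * Complex.I)) :=
    (continuous_quadPoly v).comp continuous_exp_mul_I
  have h2 : ∀ θ ∈ Icc 0 (2 * Real.pi), quadPoly v (Complex.exp (θ * Complex.I)) = 0 := by
    by_contra! hne
    obtain ⟨θ, hθ, hne⟩ := hne
    have := intervalIntegral.integral_pos
      (f := fun θ : ℝ => quadPoly v (Complex.exp (θ * Complex.I)) ^ 2) Real.two_pi_pos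
      (hc.pow 2).continuousOn (fun x _ => sq_nonneg _) ⟨θ, hθ, by positivity⟩
    linarith
  refine eq_zero_of_quadPoly_circle fun θ => ?_
  have hp : Function.Periodic (fun θ : ℝ => quadPoly v (Complex.exp (θ * Complex.I)))
      (2 * Real.pi) := fun x => by
    simp only
    congr 1
    push_cast
    rw [add_mul, Complex.exp_add, Complex.exp_two_pi_mul_I, mul_one]
  obtain ⟨y, hy, hxy⟩ := hp.exists_mem_Ico₀ Real.two_pi_pos θ
  exact hxy.trans (h2 y (Ico_subset_Icc_self hy))

/-- Nearly circular curves have an approximating conic for which the low moments of the equation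
vanish. -/
theorem exists_quadPoly_moments_eq_zero {ε : ℝ} (hε : 0 < ε) : ∃ η : ℝ, 0 < η ∧ ∀ ν : ℝ → ℝ,
    Continuous ν → (∀ θ, |ν θ| ≤ η) → ∃ v : Fin 5 → ℝ, ‖v‖ < ε ∧
      ∀ i, ∫ θ in (0 : ℝ)..(2 * Real.pi), (‖polar ν θ‖ ^ 2 - 1 + quadPoly v (polar ν θ)) *
        quadMonomial i (Complex.exp (θ * Complex.I)) = 0 := by
  obtain ⟨C, hC, hanti⟩ := (moments _ continuous_exp_mul_I).exists_antilipschitzWith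
    ker_moments_circle
  have hC' : (0 : ℝ) < C := hC
  have hπ := Real.pi_pos
  have hest : ∀ v, ‖v‖ ≤ C * ‖moments _ continuous_exp_mul_I v‖ := fun v => by
    have := hanti.le_mul_dist v 0
    simpa using this
  refine ⟨min (1 / (240 * Real.pi * C)) (min 1 (ε / (48 * Real.pi * C))), by positivity,
    fun ν hν hνη => ?_⟩
  set η := min (1 / (240 * Real.pi * C)) (min 1 (ε / (48 * Real.pi * C))) with hη
  have hη1 : η ≤ 1 := (min_le_right _ _).trans (min_le_left _ _)
  have hη0 : 0 < η := by positivity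
  have hη2 : 240 * Real.pi * C * η ≤ 1 := by
    have : η ≤ 1 / (240 * Real.pi * C) := min_le_left _ _
    rw [le_div_iff₀ (by positivity)] at this
    linarith
  have hη3 : 48 * Real.pi * C * η ≤ ε := by
    have : η ≤ ε / (48 * Real.pi * C) := (min_le_right _ _).trans (min_le_right _ _)
    rw [le_div_iff₀ (by positivity)] at this
    linarith
  have hnorm : ∀ θ : ℝ, ‖Complex.exp (θ * Complex.I)‖ = 1 := Complex.norm_exp_ofReal_mul_I
  have hcm : ∀ i, Continuous fun θ : ℝ => quadMonomial i (Complex.exp (θ * Complex.I)) := fun i =>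
    (continuous_quadMonomial i).comp continuous_exp_mul_I
  set T := moments _ (continuous_polar hν) with hT
  have hdiff : ∀ v, ‖moments _ continuous_exp_mul_I v - T v‖ ≤ 120 * Real.pi * η * ‖v‖ := by
    intro v
    refine (pi_norm_le_iff_of_nonneg (by positivity)).2 fun i => ?_
    have e : (moments _ continuous_exp_mul_I v - T v) i = ∫ θ in (0 : ℝ)..(2 * Real.pi),
        (quadPoly v (Complex.exp (θ * Complex.I)) - quadPoly v (polar ν θ)) *
          quadMonomial i (Complex.exp (θ * Complex.I)) := by
      simp only [sub_mul]
      rw [intervalIntegral.integral_sub]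
      · rfl
      · exact (((continuous_quadPoly v).comp continuous_exp_mul_I).mul
          (hcm i)).intervalIntegrable _ _
      · exact (((continuous_quadPoly v).comp (continuous_polar hν)).mul
          (hcm i)).intervalIntegrable _ _
    rw [e]
    have := intervalIntegral.norm_integral_le_of_norm_le_const (a := 0) (b := 2 * Real.pi)
      (C := 30 * η * ‖v‖ * 2) (f := fun θ : ℝ =>
        (quadPoly v (Complex.exp (θ * Complex.I)) - quadPoly v (polar ν θ)) *
          quadMonomial i (Complex.exp (θ * Complex.I))) (fun θ _ => by
        rw [norm_mul, Real.norm_eq_abs, Real.norm_eq_abs, abs_sub_comm]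
        exact mul_le_mul (abs_quadPoly_sub_le hη1 (hνη θ) (hnorm θ) v)
          (abs_quadMonomial_le (hnorm θ) i) (abs_nonneg _) (by positivity))
    refine this.trans_eq ?_
    rw [sub_zero, abs_of_pos (by positivity)]
    ring
  have hTest : ∀ v, ‖v‖ ≤ 2 * C * ‖T v‖ := by
    intro v
    have h1 := hest v
    have h2 : ‖moments _ continuous_exp_mul_I v‖ ≤
        ‖moments _ continuous_exp_mul_I v - T v‖ + ‖T v‖ := norm_le_norm_sub_add _ _
    have h3 := hdiff v
    have h4 : C * ‖moments _ continuous_exp_mul_I v‖ ≤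
        C * (120 * Real.pi * η * ‖v‖ + ‖T v‖) := by gcongr; linarith
    have h5 : 240 * Real.pi * C * η * ‖v‖ ≤ 1 * ‖v‖ := by gcongr
    linarith
  have hinj : Function.Injective T := by
    rw [← LinearMap.ker_eq_bot, LinearMap.ker_eq_bot']
    intro v hv
    have := hTest v
    rw [hv, norm_zero, mul_zero] at this
    exact norm_le_zero_iff.1 this
  set b : Fin 5 → ℝ := fun i => ∫ θ in (0 : ℝ)..(2 * Real.pi), (‖polar ν θ‖ ^ 2 - 1) *
    quadMonomial i (Complex.exp (θ * Complex.I)) with hb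
  have hbound : ‖b‖ ≤ 12 * Real.pi * η := by
    refine (pi_norm_le_iff_of_nonneg (by positivity)).2 fun i => ?_
    have := intervalIntegral.norm_integral_le_of_norm_le_const (a := 0) (b := 2 * Real.pi)
      (C := 3 * η * 2) (f := fun θ : ℝ => (‖polar ν θ‖ ^ 2 - 1) *
        quadMonomial i (Complex.exp (θ * Complex.I))) (fun θ _ => by
        rw [norm_mul, Real.norm_eq_abs, Real.norm_eq_abs]
        refine mul_le_mul ?_ (abs_quadMonomial_le (hnorm θ) i) (abs_nonneg _) (by positivity)
        rw [polar, norm_mul, hnorm, mul_one, Complex.norm_real, Real.norm_eq_abs, sq_abs]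
        have : (1 + ν θ) ^ 2 - 1 = ν θ * (2 + ν θ) := by ring
        rw [this, abs_mul]
        have h3 : |2 + ν θ| ≤ 3 := by
          have := abs_le.1 (hνη θ)
          exact abs_le.2 ⟨by linarith, by linarith⟩
        have := mul_le_mul (hνη θ) h3 (abs_nonneg _) hη0.le
        linarith)
    refine this.trans_eq ?_
    rw [sub_zero, abs_of_pos (by positivity)]
    ring
  obtain ⟨v, hv⟩ := LinearMap.surjective_of_injective hinj (-b)
  refine ⟨v, ?_, fun i => ?_⟩
  · have h1 := hTest v
    rw [hv, norm_neg] at h1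
    have h2 : 2 * C * ‖b‖ ≤ 2 * C * (12 * Real.pi * η) := by gcongr
    have h3 : 0 < Real.pi * C * η := by positivity
    linarith
  · simp only [add_mul]
    have hcn : Continuous fun θ => ‖polar ν θ‖ ^ 2 - 1 :=
      ((continuous_polar hν).norm.pow 2).sub continuous_const
    rw [intervalIntegral.integral_add]
    · have : T v i = -b i := congrFun hv i
      have e : T v i = ∫ θ in (0 : ℝ)..(2 * Real.pi), quadPoly v (polar ν θ) *
        quadMonomial i (Complex.exp (θ * Complex.I)) := rfl
      rw [← e, this, hb, add_neg_cancel]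
    · exact (hcn.mul (hcm i)).intervalIntegrable _ _
    · exact (((continuous_quadPoly v).comp (continuous_polar hν)).mul
          (hcm i)).intervalIntegrable _ _

/-- A real function all whose low moments vanish has vanishing low Fourier coefficients. -/
theorem fourierC_eq_zero_of_moments {Φ : ℝ → ℝ} (hΦ : Continuous Φ)
    (h : ∀ i, ∫ θ in (0 : ℝ)..(2 * Real.pi),
      Φ θ * quadMonomial i (Complex.exp (θ * Complex.I)) = 0) {k : ℤ} (hk : |(k : ℝ)| ≤ 2) :
    fourierC (fun θ => (Φ θ : ℂ)) k = 0 := by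
  obtain ⟨c, hc⟩ : ∃ c : Fin 5 → ℂ, ∀ θ : ℝ, Complex.exp (-(k * θ * Complex.I)) =
      ∑ i, c i * (quadMonomial i (Complex.exp (θ * Complex.I)) : ℂ) := by
    have hconj : ∀ θ : ℝ, Complex.exp (-(θ * Complex.I)) =
        (starRingEnd ℂ) (Complex.exp (θ * Complex.I)) := fun θ => by
      rw [← Complex.exp_conj]; simp
    have hk' : |k| ≤ 2 := by exact_mod_cast hk
    rw [abs_le] at hk'
    obtain ⟨h1, h2⟩ := hk'
    have hz : ∀ z : ℂ, z = z.re + z.im * Complex.I := fun z => (Complex.re_add_im z).symm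
    have hz' : ∀ z : ℂ, (starRingEnd ℂ) z = z.re - z.im * Complex.I := fun z => by
      rw [Complex.ext_iff]; simp
    interval_cases k
    · refine ⟨![0, 0, 0, 1, Complex.I], fun θ => ?_⟩
      have : -(((-2 : ℤ) : ℂ) * θ * Complex.I) = θ * Complex.I + θ * Complex.I := by
        push_cast; ring
      rw [this, Complex.exp_add]
      set z := Complex.exp (θ * Complex.I)
      simp [Fin.sum_univ_five, quadMonomial]
      have e : z * z = (z.re + z.im * Complex.I) * (z.re + z.im * Complex.I) := by rw [← hz z]
      rw [e]
      linear_combination (z.im : ℂ) ^ 2 * Complex.I_sq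
    · refine ⟨![0, 1, Complex.I, 0, 0], fun θ => ?_⟩
      have : -(((-1 : ℤ) : ℂ) * θ * Complex.I) = θ * Complex.I := by push_cast; ring
      rw [this]
      set z := Complex.exp (θ * Complex.I)
      simp [Fin.sum_univ_five, quadMonomial]
      nth_rewrite 1 [hz z]
      ring
    · exact ⟨![1, 0, 0, 0, 0], fun θ => by simp [Fin.sum_univ_five, quadMonomial]⟩
    · refine ⟨![0, 1, -Complex.I, 0, 0], fun θ => ?_⟩
      have : -(((1 : ℤ) : ℂ) * θ * Complex.I) = -(θ * Complex.I) := by push_cast; ring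
      rw [this, hconj, hz']
      simp [Fin.sum_univ_five, quadMonomial]
      ring
    · refine ⟨![0, 0, 0, 1, -Complex.I], fun θ => ?_⟩
      have : -(((2 : ℤ) : ℂ) * θ * Complex.I) = -(θ * Complex.I) + -(θ * Complex.I) := by
        push_cast; ring
      rw [this, Complex.exp_add, hconj, hz']
      set z := Complex.exp (θ * Complex.I)
      simp [Fin.sum_univ_five, quadMonomial]
      linear_combination (z.im : ℂ) ^ 2 * Complex.I_sq
  rw [fourierC]
  have e : ∀ θ : ℝ, Complex.exp (-(k * θ * Complex.I)) * (Φ θ : ℂ) = ∑ i, c i *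
      ((Φ θ * quadMonomial i (Complex.exp (θ * Complex.I)) : ℝ) : ℂ) := by
    intro θ
    rw [hc, Finset.sum_mul]
    exact Finset.sum_congr rfl fun i _ => by push_cast; ring
  simp only [e]
  rw [intervalIntegral.integral_finsetSum]
  · rw [Finset.sum_eq_zero, mul_zero]
    intro i _
    rw [intervalIntegral.integral_const_mul, intervalIntegral.integral_ofReal, h i]
    simp
  · intro i _
    exact (continuous_const.mul (Complex.continuous_ofReal.comp
      (hΦ.mul ((continuous_quadMonomial i).comp continuous_exp_mul_I)))).intervalIntegrable _ _


theorem uniformlyBounded_exp {ι : Type*} (m : ℕ) :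
    UniformlyBounded m fun (_ : ι) (θ : ℝ) => Complex.exp (-(θ * Complex.I)) := by
  have hn : ∀ θ : ℝ, ‖Complex.exp (-(θ * Complex.I))‖ ≤ 1 := fun θ => by
    simpa using (norm_exp_neg_int_mul 1 θ).le
  induction m with
  | zero => exact ⟨1, fun _ => ⟨by fun_prop, hn⟩⟩
  | succ m ih =>
    refine UniformlyBounded.succ' (f' := fun _ θ => (-Complex.I) * Complex.exp (-(θ * Complex.I)))
      (fun _ θ => ?_) ⟨1, fun _ => hn⟩
      ((UniformlyBounded.const (C := 1) (fun _ => by simp)).mul ih)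
    have h1 : HasDerivAt (fun θ : ℝ => -((θ : ℂ) * Complex.I)) (-(1 * Complex.I)) θ :=
      ((hasDerivAt_id θ).ofReal_comp.mul_const _).neg
    have := h1.cexp
    rwa [one_mul, mul_comm] at this

/-- The affine image of a polar curve, in a frame rotating with the polar angle. -/
def rotatedImage (ν : ℝ → ℝ) (A B D : ℂ) (θ : ℝ) : ℂ :=
  (A + B * (Complex.exp (-(θ * Complex.I)) * Complex.exp (-(θ * Complex.I)))) * (1 + (ν θ : ℂ)) +
    D * Complex.exp (-(θ * Complex.I))

theorem rotatedImage_mul_exp (ν : ℝ → ℝ) (A B D : ℂ) (θ : ℝ) :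
    rotatedImage ν A B D θ * Complex.exp (θ * Complex.I) =
      A * polar ν θ + B * (starRingEnd ℂ) (polar ν θ) + D := by
  have h1 : (starRingEnd ℂ) (polar ν θ) = (1 + (ν θ : ℂ)) * Complex.exp (-(θ * Complex.I)) := by
    rw [polar, map_mul, ← Complex.exp_conj, Complex.conj_ofReal]
    simp
  have h2 : Complex.exp (-(θ * Complex.I)) * Complex.exp (θ * Complex.I) = 1 := by
    rw [← Complex.exp_add, neg_add_cancel, Complex.exp_zero]
  rw [h1, rotatedImage, polar]
  push_cast
  linear_combination (B * Complex.exp (-(θ * Complex.I)) * (1 + (ν θ : ℂ)) + D) * h2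

section

variable {ν : ℝ → ℝ} {A B D : ℂ} {μ : ℝ}

theorem hasDerivAt_rotatedImage {θ ν' : ℝ} (h : HasDerivAt ν ν' θ) :
    HasDerivAt (rotatedImage ν A B D)
      ((A + B * (Complex.exp (-(θ * Complex.I)) * Complex.exp (-(θ * Complex.I)))) * ν' -
        2 * Complex.I * B * (Complex.exp (-(θ * Complex.I)) * Complex.exp (-(θ * Complex.I))) *
          (1 + (ν θ : ℂ)) - Complex.I * D * Complex.exp (-(θ * Complex.I))) θ := by
  have h1 : HasDerivAt (fun θ : ℝ => -((θ : ℂ) * Complex.I)) (-(1 * Complex.I)) θ :=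
    ((hasDerivAt_id θ).ofReal_comp.mul_const _).neg
  have h2 := h1.cexp
  have := ((((h2.mul h2).const_mul B).const_add A).mul (h.ofReal_comp.const_add 1)).add
    (h2.const_mul D)
  have h3 := this.congr_deriv (g' := (A + B * (Complex.exp (-(θ * Complex.I)) *
    Complex.exp (-(θ * Complex.I)))) * ν' - 2 * Complex.I * B * (Complex.exp (-(θ * Complex.I)) *
      Complex.exp (-(θ * Complex.I))) * (1 + (ν θ : ℂ)) -
      Complex.I * D * Complex.exp (-(θ * Complex.I))) (by simp only [Pi.mul_apply]; ring)
  exact h3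

theorem norm_rotatedImage_sub_one_le (hμ : μ ≤ 1 / 100) {θ : ℝ} (hν : |ν θ| ≤ μ)
    (hA : ‖A - 1‖ ≤ μ) (hB : ‖B‖ ≤ μ) (hD : ‖D‖ ≤ μ) : ‖rotatedImage ν A B D θ - 1‖ ≤ 5 * μ := by
  have hn : ‖Complex.exp (-(θ * Complex.I))‖ = 1 := by simpa using norm_exp_neg_int_mul 1 θ
  set E := Complex.exp (-(θ * Complex.I)) with hE
  have hμ0 : 0 ≤ μ := (abs_nonneg _).trans hν
  have hν' : ‖(ν θ : ℂ)‖ ≤ μ := by rwa [Complex.norm_real]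
  have e : rotatedImage ν A B D θ - 1 =
      (A - 1) + (A - 1) * ν θ + ν θ + B * (E * E) + B * (E * E) * ν θ + D * E := by
    rw [rotatedImage]; ring
  have h1 : ‖(A - 1) * ν θ‖ ≤ μ * μ := by rw [norm_mul]; gcongr
  have h2 : ‖B * (E * E)‖ ≤ μ := by rwa [norm_mul, norm_mul, hn, mul_one, mul_one]
  have h3 : ‖B * (E * E) * ν θ‖ ≤ μ * μ := by rw [norm_mul]; gcongr
  have h4 : ‖D * E‖ ≤ μ := by rwa [norm_mul, hn, mul_one]
  rw [e]
  have t1 := norm_add_le ((A - 1) + (A - 1) * ν θ + ν θ + B * (E * E) + B * (E * E) * ν θ) (D * E)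
  have t2 := norm_add_le ((A - 1) + (A - 1) * ν θ + ν θ + B * (E * E)) (B * (E * E) * ν θ)
  have t3 := norm_add_le ((A - 1) + (A - 1) * ν θ + ν θ) (B * (E * E))
  have t4 := norm_add_le ((A - 1) + (A - 1) * ν θ) (ν θ : ℂ)
  have t5 := norm_add_le (A - 1) ((A - 1) * ν θ)
  nlinarith

theorem norm_deriv_rotatedImage_le (hμ : μ ≤ 1 / 100) (hd : Differentiable ℝ ν) {θ : ℝ}
    (hν : |ν θ| ≤ μ) (hν' : |deriv ν θ| ≤ μ)
    (hA : ‖A - 1‖ ≤ μ) (hB : ‖B‖ ≤ μ) (hD : ‖D‖ ≤ μ) :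
    ‖deriv (rotatedImage ν A B D) θ‖ ≤ 6 * μ := by
  rw [(hasDerivAt_rotatedImage (hd θ).hasDerivAt).deriv]
  have hn : ‖Complex.exp (-(θ * Complex.I))‖ = 1 := by simpa using norm_exp_neg_int_mul 1 θ
  set E := Complex.exp (-(θ * Complex.I)) with hE
  have hμ0 : 0 ≤ μ := (abs_nonneg _).trans hν
  have hν1 : ‖(ν θ : ℂ)‖ ≤ μ := by rwa [Complex.norm_real]
  have hν2 : ‖((deriv ν θ : ℝ) : ℂ)‖ ≤ μ := by rwa [Complex.norm_real]
  have h2 : ‖B * (E * E)‖ ≤ μ := by rwa [norm_mul, norm_mul, hn, mul_one, mul_one]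
  have h3 : ‖A + B * (E * E)‖ ≤ 1 + 2 * μ := by
    have e : A + B * (E * E) = 1 + (A - 1) + B * (E * E) := by ring
    rw [e]
    have t1 := norm_add_le (1 + (A - 1)) (B * (E * E))
    have t2 := norm_add_le 1 (A - 1)
    rw [norm_one] at t2
    linarith
  have h4 : ‖(A + B * (E * E)) * (deriv ν θ : ℝ)‖ ≤ (1 + 2 * μ) * μ := by
    rw [norm_mul]; gcongr
  have h5 : ‖1 + (ν θ : ℂ)‖ ≤ 1 + μ := by
    have := norm_add_le 1 (ν θ : ℂ)
    rw [norm_one] at this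
    linarith
  have h6 : ‖2 * Complex.I * B * (E * E) * (1 + (ν θ : ℂ))‖ ≤ 2 * μ * (1 + μ) := by
    have e : 2 * Complex.I * B * (E * E) * (1 + (ν θ : ℂ)) =
      2 * Complex.I * (B * (E * E)) * (1 + (ν θ : ℂ)) := by ring
    rw [e, norm_mul, norm_mul, norm_mul, Complex.norm_I, Complex.norm_ofNat, mul_one]
    gcongr
  have h7 : ‖Complex.I * D * E‖ ≤ μ := by
    rwa [norm_mul, norm_mul, hn, mul_one, Complex.norm_I, one_mul]
  have t1 := norm_sub_le ((A + B * (E * E)) * (deriv ν θ : ℝ) -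
    2 * Complex.I * B * (E * E) * (1 + (ν θ : ℂ))) (Complex.I * D * E)
  have t2 := norm_sub_le ((A + B * (E * E)) * (deriv ν θ : ℝ))
    (2 * Complex.I * B * (E * E) * (1 + (ν θ : ℂ)))
  nlinarith

theorem rotatedImage_periodic (h : Function.Periodic ν (2 * Real.pi)) :
    Function.Periodic (rotatedImage ν A B D) (2 * Real.pi) := fun θ => by
  have : Complex.exp (-(((θ + 2 * Real.pi : ℝ) : ℂ) * Complex.I)) =
      Complex.exp (-(θ * Complex.I)) := by
    simpa using exp_neg_int_mul_add_two_pi 1 θ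
  rw [rotatedImage, rotatedImage, h θ, this]

end

theorem uniformlyBounded_rotatedImage {ι : Type*} {ν : ι → ℝ → ℝ} {A B D : ι → ℂ}
    {m : ℕ} (hν : UniformlyBounded m ν) (hA : ∀ i, ‖A i - 1‖ ≤ 1)
    (hB : ∀ i, ‖B i‖ ≤ 1) (hD : ∀ i, ‖D i‖ ≤ 1) :
    UniformlyBounded m fun i => rotatedImage (ν i) (A i) (B i) (D i) := by
  have hA' : ∀ i, ‖A i‖ ≤ 2 := fun i => by
    have := norm_add_le (A i - 1) 1
    rw [sub_add_cancel, norm_one] at this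
    linarith [hA i]
  have hE := uniformlyBounded_exp (ι := ι) m
  exact (((UniformlyBounded.const hA').add ((UniformlyBounded.const hB).mul (hE.mul hE))).mul
    ((UniformlyBounded.const (c := fun _ => (1 : ℂ)) (C := 1) fun _ => by simp).add
      (hν.clm_comp Complex.ofRealCLM))).add ((UniformlyBounded.const hD).mul hE)

/-- `h` is a small perturbation of the identity that commutes with the translation by `2π`. -/
structure IsReparam (μ : ℝ) (h : ℝ → ℝ) : Prop where
  differentiable : Differentiable ℝ h
  continuous_deriv : Continuous (deriv h)
  abs_deriv_sub_one_le : ∀ x, |deriv h x - 1| ≤ 12 * μ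
  abs_sub_le : ∀ x, |h x - x| ≤ 8 * μ
  add_two_pi : ∀ x, h (x + 2 * Real.pi) = h x + 2 * Real.pi

namespace IsReparam

variable {μ : ℝ} {h : ℝ → ℝ}

theorem deriv_ge (hh : IsReparam μ h) (hμ : μ ≤ 1 / 100) (x : ℝ) : 1 / 2 ≤ deriv h x := by
  have := (abs_le.1 (hh.abs_deriv_sub_one_le x)).1
  linarith

theorem strictMono (hh : IsReparam μ h) (hμ : μ ≤ 1 / 100) : StrictMono h :=
  strictMono_of_deriv_pos fun x => by linarith [hh.deriv_ge hμ x]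

theorem surjective (hh : IsReparam μ h) : Function.Surjective h := by
  refine hh.differentiable.continuous.surjective
    (tendsto_atTop_mono (f := fun x => x + -(8 * μ)) (fun x => ?_)
      (tendsto_atTop_add_const_right _ _ tendsto_id))
    (tendsto_atBot_mono (f := fun x => x + 8 * μ) (g := h) (fun x => ?_)
      (tendsto_atBot_add_const_right _ _ tendsto_id))
  · linarith [(abs_le.1 (hh.abs_sub_le x)).1]
  · linarith [(abs_le.1 (hh.abs_sub_le x)).2]

theorem exists_inverse (hh : IsReparam μ h) (hμ : μ ≤ 1 / 100) : ∃ g : ℝ → ℝ,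
    (∀ x, g (h x) = x) ∧ (∀ x, h (g x) = x) ∧ (∀ x, g (x + 2 * Real.pi) = g x + 2 * Real.pi) ∧
      ∀ x, HasDerivAt g (deriv h (g x))⁻¹ x := by
  let e := (hh.strictMono hμ).orderIsoOfSurjective h hh.surjective
  have he : ∀ x, e x = h x := fun x => rfl
  have h1 : ∀ x, e.symm (h x) = x := fun x => by rw [← he, e.symm_apply_apply]
  have h2 : ∀ x, h (e.symm x) = x := fun x => by rw [← he, e.apply_symm_apply]
  refine ⟨e.symm, h1, h2, fun x => ?_, fun x => ?_⟩
  · apply (hh.strictMono hμ).injective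
    rw [hh.add_two_pi, h2, h2]
  · exact HasDerivAt.of_local_left_inverse e.symm.continuous.continuousAt
      (hh.differentiable _).hasDerivAt (by linarith [hh.deriv_ge hμ (e.symm x)])
      (Eventually.of_forall h2)

end IsReparam

/-- Affine images of nearly circular curves are polar curves, with uniform bounds. -/
theorem exists_reparam {ι : Type*} {ν : ι → ℝ → ℝ} {A B D : ι → ℂ} {μ : ι → ℝ}
    (hμ : ∀ i, μ i ≤ 1 / 100)
    {m : ℕ} (hν : UniformlyBounded (m + 1) ν)
    (hper : ∀ i, Function.Periodic (ν i) (2 * Real.pi))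
    (hν0 : ∀ i x, |ν i x| ≤ μ i) (hν1 : ∀ i x, |deriv (ν i) x| ≤ μ i) (hA : ∀ i, ‖A i - 1‖ ≤ μ i)
    (hB : ∀ i, ‖B i‖ ≤ μ i) (hD : ∀ i, ‖D i‖ ≤ μ i) :
    ∃ h s : ι → ℝ → ℝ, (UniformlyBounded (m + 1) fun i x => (s i x : ℂ)) ∧ ∀ i,
      IsReparam (μ i) (h i) ∧ Function.Periodic (s i) (2 * Real.pi) ∧ Differentiable ℝ (s i) ∧
      (∀ x, |s i x| ≤ 8 * μ i) ∧ ∀ θ, logPolar (s i) (h i θ) =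
        A i * polar (ν i) θ + B i * (starRingEnd ℂ) (polar (ν i) θ) + D i := by
  set w : ι → ℝ → ℂ := fun i => rotatedImage (ν i) (A i) (B i) (D i) with hw
  have hw1 : ∀ i x, ‖w i x - 1‖ ≤ 5 * μ i := fun i x =>
    norm_rotatedImage_sub_one_le (hμ i) (hν0 i x) (hA i) (hB i) (hD i)
  have hwd : ∀ i x, ‖deriv (w i) x‖ ≤ 6 * μ i := fun i x =>
    norm_deriv_rotatedImage_le (hμ i) (hν.differentiable i) (hν0 i x) (hν1 i x) (hA i) (hB i) (hD i)
  have hwn : ∀ i x, 1 / 2 ≤ ‖w i x‖ := fun i x => by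
    have := norm_sub_norm_le 1 (1 - w i x)
    rw [sub_sub_cancel, norm_one, norm_sub_rev] at this
    linarith [hw1 i x, hμ i]
  have hw0 : ∀ i x, w i x ≠ 0 := fun i x => norm_pos_iff.1 (by linarith [hwn i x])
  have hlog : ∀ i x, ‖Complex.log (w i x)‖ ≤ 8 * μ i := fun i x => by
    have h1 := hw1 i x
    have h0 := hμ i
    have := Complex.norm_log_one_add_half_le_self (z := w i x - 1) (by linarith)
    rw [add_sub_cancel] at this
    have h2 : 0 ≤ ‖w i x - 1‖ := norm_nonneg _
    linarith
  have hslit : ∀ i x, w i x ∈ Complex.slitPlane := fun i x => by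
    have h1 := hw1 i x
    have h0 := hμ i
    refine Complex.mem_slitPlane_iff.2 (Or.inl ?_)
    have := (abs_le.1 ((Complex.abs_re_le_norm (w i x - 1)).trans h1)).1
    rw [Complex.sub_re, Complex.one_re] at this
    linarith
  have hwU : UniformlyBounded (m + 1) w :=
    uniformlyBounded_rotatedImage hν (fun i => (hA i).trans (by linarith [hμ i]))
      (fun i => (hB i).trans (by linarith [hμ i])) (fun i => (hD i).trans (by linarith [hμ i]))
  have hℓU : UniformlyBounded (m + 1) fun i x => Complex.log (w i x) :=
    UniformlyBounded.clog (by norm_num) hwn hslit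
      ⟨1, fun i x => (hlog i x).trans (by linarith [hμ i])⟩ hwU
  have hℓd : ∀ i x, HasDerivAt (fun x => Complex.log (w i x)) (deriv (w i) x / w i x) x :=
    fun i x => (hwU.differentiable i x).hasDerivAt.clog_real (hslit i x)
  have hℓd' : ∀ i x, ‖deriv (w i) x / w i x‖ ≤ 12 * μ i := fun i x => by
    have hpos : 0 < ‖w i x‖ := by linarith [hwn i x]
    rw [norm_div, div_le_iff₀ hpos]
    have h1 := hwd i x
    have h2 := norm_nonneg (deriv (w i) x)
    nlinarith [hwn i x]
  set h : ι → ℝ → ℝ := fun i x => x + (Complex.log (w i x)).im with hh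
  have hhd : ∀ i x, HasDerivAt (h i) (1 + (deriv (w i) x / w i x).im) x := fun i x =>
    (hasDerivAt_id x).add (Complex.imCLM.hasFDerivAt.comp_hasDerivAt x (hℓd i x))
  have hhderiv : ∀ i, deriv (h i) = fun x => 1 + (deriv (fun x => Complex.log (w i x)) x).im :=
    fun i => funext fun x => by rw [(hhd i x).deriv, (hℓd i x).deriv]
  have hhU : UniformlyBounded m fun i => deriv (h i) := by
    simp only [hhderiv]
    exact (UniformlyBounded.const (c := fun _ => (1 : ℝ)) (C := 1) fun _ => by simp).add
      (hℓU.deriv.clm_comp Complex.imCLM)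
  have hwper : ∀ i, Function.Periodic (w i) (2 * Real.pi) := fun i => rotatedImage_periodic (hper i)
  have hrep : ∀ i, IsReparam (μ i) (h i) := fun i =>
    { differentiable := fun x => (hhd i x).differentiableAt
      continuous_deriv := hhU.continuous i
      abs_deriv_sub_one_le := fun x => by
        rw [(hhd i x).deriv, add_sub_cancel_left]
        exact (Complex.abs_im_le_norm _).trans (hℓd' i x)
      abs_sub_le := fun x => by
        simp only [hh, add_sub_cancel_left]
        exact (Complex.abs_im_le_norm _).trans (hlog i x)
      add_two_pi := fun x => by
        simp only [hh, hwper i x]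
        ring }
  choose g hg1 hg2 hg3 hg4 using fun i => (hrep i).exists_inverse (hμ i)
  have hgU : UniformlyBounded m fun i => deriv (g i) :=
    UniformlyBounded.deriv_inverse (by norm_num : (0 : ℝ) < 1 / 2) hhU
      (fun i x => (hrep i).deriv_ge (hμ i) x) hg4
  have hsU : UniformlyBounded (m + 1) fun i x => (Complex.log (w i (g i x))).re :=
    UniformlyBounded.comp (F := fun i x => (Complex.log (w i x)).re)
      (hℓU.clm_comp Complex.reCLM) (fun i x => (hg4 i x).differentiableAt) hgU
  refine ⟨h, fun i x => (Complex.log (w i (g i x))).re, hsU.clm_comp Complex.ofRealCLM,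
    fun i => ⟨hrep i, fun x => ?_, hsU.differentiable i, fun x => ?_, fun θ => ?_⟩⟩
  · simp only [hg3 i x, hwper i (g i x)]
  · exact (Complex.abs_re_le_norm _).trans (hlog i _)
  · rw [← rotatedImage_mul_exp, logPolar]
    simp only [hg1]
    simp only [hh]
    have e : (((Complex.log (w i θ)).re : ℝ) : ℂ) +
        ((θ + (Complex.log (w i θ)).im : ℝ) : ℂ) * Complex.I =
        Complex.log (w i θ) + θ * Complex.I := by
      nth_rewrite 3 [← Complex.re_add_im (Complex.log (w i θ))]
      push_cast
      ring
    rw [e, Complex.exp_add, Complex.exp_log (hw0 i θ)]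

theorem IsReparam.fourierC_eq {μ : ℝ} {h : ℝ → ℝ} (hh : IsReparam μ h) {s : ℝ → ℂ}
    (hs : Continuous s) (hper : Function.Periodic s (2 * Real.pi)) (k : ℤ) :
    fourierC s k = (1 / (2 * Real.pi) : ℝ) * ∫ θ in (0 : ℝ)..(2 * Real.pi),
      deriv h θ • (Complex.exp (-(k * (h θ : ℝ) * Complex.I)) * s (h θ)) := by
  have hp : Function.Periodic (fun y : ℝ => Complex.exp (-(k * y * Complex.I)) * s y)
      (2 * Real.pi) := fun y => by
    simp only [exp_neg_int_mul_add_two_pi, hper y]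
  have h1 := intervalIntegral.integral_deriv_smul_comp (a := 0) (b := 2 * Real.pi)
    (g := fun y : ℝ => Complex.exp (-(k * y * Complex.I)) * s y)
    (fun x _ => (hh.differentiable x).hasDerivAt) hh.continuous_deriv.continuousOn (by fun_prop)
  simp only [Function.comp_def] at h1
  have h2 := hh.add_two_pi 0
  rw [zero_add] at h2
  have h3 := hp.intervalIntegral_add_eq (h 0) 0
  rw [zero_add] at h3
  rw [h1, h2, h3, fourierC]

theorem IsReparam.norm_fourierC_le {μ : ℝ} {h : ℝ → ℝ} (hh : IsReparam μ h) (hμ : μ ≤ 1 / 100)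
    {s : ℝ → ℝ} (hs : Continuous s) (hper : Function.Periodic s (2 * Real.pi))
    (hsμ : ∀ x, |s x| ≤ 8 * μ) {X : ℝ} (hX : ∀ x, |s x| ≤ X) {k : ℤ} (hk : |(k : ℝ)| ≤ 2)
    (h0 : fourierC (fun θ => ((Real.exp (2 * s (h θ)) - 1 : ℝ) : ℂ)) k = 0) :
    ‖fourierC (fun x => (s x : ℂ)) k‖ ≤ 44 * μ * X := by
  have hsc : Continuous fun x => (s x : ℂ) := Complex.continuous_ofReal.comp hs
  have hhc := hh.differentiable.continuous
  have hh' := hh.continuous_deriv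
  have hX0 : 0 ≤ X := (abs_nonneg _).trans (hX 0)
  have e : fourierC (fun x => (s x : ℂ)) k = (1 / (2 * Real.pi) : ℝ) *
      ∫ θ in (0 : ℝ)..(2 * Real.pi),
        (deriv h θ • (Complex.exp (-(k * (h θ : ℝ) * Complex.I)) * (s (h θ) : ℂ)) - (1 / 2) *
          (Complex.exp (-(k * θ * Complex.I)) * ((Real.exp (2 * s (h θ)) - 1 : ℝ) : ℂ))) := by
    rw [intervalIntegral.integral_sub, intervalIntegral.integral_const_mul, mul_sub,
      ← hh.fourierC_eq hsc (fun x => by simp only [hper x])]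
    · rw [fourierC] at h0
      linear_combination (1 / 2) * h0
    · refine Continuous.intervalIntegrable ?_ _ _
      fun_prop
    · refine Continuous.intervalIntegrable ?_ _ _
      fun_prop
  have hpt : ∀ θ : ℝ,
      ‖deriv h θ • (Complex.exp (-(k * (h θ : ℝ) * Complex.I)) * (s (h θ) : ℂ)) - (1 / 2) *
          (Complex.exp (-(k * θ * Complex.I)) * ((Real.exp (2 * s (h θ)) - 1 : ℝ) : ℂ))‖
        ≤ 44 * μ * X := by
    intro θ
    set E := Complex.exp (-(k * θ * Complex.I)) with hE
    have hE1 : ‖E‖ = 1 := norm_exp_neg_int_mul k θ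
    set E' := Complex.exp (Complex.I * ((-(k * (h θ - θ)) : ℝ) : ℂ)) with hE'
    have hEE : Complex.exp (-(k * (h θ : ℝ) * Complex.I)) = E * E' := by
      rw [hE, hE', ← Complex.exp_add]
      congr 1
      push_cast
      ring
    have hE'1 : ‖E'‖ = 1 := by rw [hE', mul_comm, Complex.norm_exp_ofReal_mul_I]
    have hE'2 : ‖E' - 1‖ ≤ 2 * (8 * μ) := by
      refine (Real.norm_exp_I_mul_ofReal_sub_one_le).trans ?_
      rw [Real.norm_eq_abs, abs_neg, abs_mul]
      exact mul_le_mul hk (hh.abs_sub_le θ) (abs_nonneg _) (by norm_num)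
    have e1 : deriv h θ • (Complex.exp (-(k * (h θ : ℝ) * Complex.I)) * (s (h θ) : ℂ)) - (1 / 2) *
        (E * ((Real.exp (2 * s (h θ)) - 1 : ℝ) : ℂ)) =
        E * ((((deriv h θ - 1 : ℝ) : ℂ) * E' + (E' - 1)) * (s (h θ) : ℂ) -
          (((Real.exp (2 * s (h θ)) - 1 - 2 * s (h θ)) / 2 : ℝ) : ℂ)) := by
      rw [hEE, Complex.real_smul]
      push_cast
      ring
    rw [e1, norm_mul, hE1, one_mul]
    have b1 : ‖((deriv h θ - 1 : ℝ) : ℂ) * E' + (E' - 1)‖ ≤ 28 * μ := by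
      refine (norm_add_le _ _).trans ?_
      rw [norm_mul, hE'1, mul_one, Complex.norm_real, Real.norm_eq_abs]
      linarith [hh.abs_deriv_sub_one_le θ]
    have b2 : ‖(((deriv h θ - 1 : ℝ) : ℂ) * E' + (E' - 1)) * (s (h θ) : ℂ)‖ ≤ 28 * μ * X := by
      rw [norm_mul, Complex.norm_real]
      exact mul_le_mul b1 (hX _) (norm_nonneg _) ((norm_nonneg _).trans b1)
    have b3 : ‖(((Real.exp (2 * s (h θ)) - 1 - 2 * s (h θ)) / 2 : ℝ) : ℂ)‖ ≤ 16 * μ * X := by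
      rw [Complex.norm_real, Real.norm_eq_abs, abs_div, abs_two]
      have c1 : |2 * s (h θ)| ≤ 1 := by
        rw [abs_mul, abs_two]
        linarith [hsμ (h θ)]
      have c2 := Real.abs_exp_sub_one_sub_id_le c1
      have c3 : (2 * s (h θ)) ^ 2 ≤ 4 * (8 * μ * X) := by
        have := mul_le_mul (hsμ (h θ)) (hX (h θ)) (abs_nonneg _) ((abs_nonneg _).trans (hsμ (h θ)))
        rw [← pow_two, sq_abs] at this
        linarith
      linarith
    refine (norm_sub_le _ _).trans ?_
    linarith
  rw [e, norm_mul, Complex.norm_real, Real.norm_of_nonneg (by positivity)]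
  have := intervalIntegral.norm_integral_le_of_norm_le_const (a := 0) (b := 2 * Real.pi)
    fun θ _ => hpt θ
  rw [sub_zero, abs_of_pos Real.two_pi_pos] at this
  calc _ ≤ 1 / (2 * Real.pi) * (44 * μ * X * (2 * Real.pi)) := by gcongr
    _ = _ := by field_simp


/-- The complex number with the same coordinates as a point of the plane. -/
def toComplex (x : Plane) : ℂ := ⟨x 0, x 1⟩

theorem area_eq_cross (x y : Plane) : area x y = cross (toComplex x) (toComplex y) := by
  simp [area, cross, toComplex]
  ring

theorem toComplex_injective : Function.Injective toComplex := fun x y h => by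
  have h0 : x 0 = y 0 := congrArg Complex.re h
  have h1 : x 1 = y 1 := congrArg Complex.im h
  ext i
  fin_cases i <;> assumption

theorem toComplex_sub (x y : Plane) : toComplex (x - y) = toComplex x - toComplex y := by
  apply Complex.ext <;> simp [toComplex]

theorem toComplex_add (x y : Plane) : toComplex (x + y) = toComplex x + toComplex y := by
  apply Complex.ext <;> simp [toComplex]

theorem toComplex_smul (c : ℝ) (x : Plane) : toComplex (c • x) = c * toComplex x := by
  apply Complex.ext <;> simp [toComplex]

/-- `toComplex` as a continuous linear map. -/
def toComplexL : Plane →L[ℝ] ℂ :=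
  LinearMap.toContinuousLinearMap
    { toFun := toComplex
      map_add' := toComplex_add
      map_smul' := fun c x => by rw [toComplex_smul]; simp }

theorem hasDerivAt_toComplex {γ : ℝ → Plane} {γ' : Plane} {t : ℝ} (h : HasDerivAt γ γ' t) :
    HasDerivAt (fun t => toComplex (γ t)) (toComplex γ') t :=
  toComplexL.hasFDerivAt.comp_hasDerivAt t h

section Phase

variable {γ : ℝ → Plane} {L : ℝ} {T : ℝ × ℝ → ℝ × ℝ}

theorem add_mem_phase (hper : Function.Periodic γ L) {p : ℝ × ℝ} (hp : p ∈ phase γ L) (m : ℤ) :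
    p + (m * L, m * L) ∈ phase γ L := by
  obtain ⟨h1, h2, h3⟩ := hp
  refine ⟨by simpa using h1, by simp only [Prod.fst_add, Prod.snd_add]; linarith, ?_⟩
  rw [Prod.fst_add, Prod.snd_add, hper.deriv'.int_mul m, hper.deriv'.int_mul m]
  exact h3

theorem IsBilliardMap.iterate_mem (hT : IsBilliardMap γ L T) {p : ℝ × ℝ} (hp : p ∈ phase γ L)
    (j : ℕ) : T^[j] p ∈ phase γ L := by
  induction j with
  | zero => exact hp
  | succ j ih =>
    rw [Function.iterate_succ_apply']
    exact (hT _ ih).1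

theorem IsBilliardMap.iterate_succ_fst (hT : IsBilliardMap γ L T) {p : ℝ × ℝ}
    (hp : p ∈ phase γ L) (j : ℕ) : (T^[j + 1] p).1 = (T^[j] p).2 := by
  rw [Function.iterate_succ_apply']
  exact (hT _ (hT.iterate_mem hp j)).2.1

theorem IsBilliardMap.iterate_fst_lt (hT : IsBilliardMap γ L T) {p : ℝ × ℝ}
    (hp : p ∈ phase γ L) {j : ℕ} (hj : 0 < j) : p.1 < (T^[j] p).1 := by
  induction j, hj using Nat.le_induction with
  | base =>
    rw [hT.iterate_succ_fst hp]
    exact hp.1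
  | succ j _ ih =>
    rw [hT.iterate_succ_fst hp]
    exact ih.trans (hT.iterate_mem hp j).1

theorem IsBilliardMap.isPolygon (hT : IsBilliardMap γ L T) (hγ : Differentiable ℝ γ)
    (hper : Function.Periodic γ L) {p : ℝ × ℝ} (hp : p ∈ phase γ L) {q : ℕ}
    (hq : T^[q] p = p + (L, L)) (M : ℤ) :
    IsPolygon (fun t => toComplex (γ t)) L q fun j => (T^[j] p).1 - M * L := by
  have hd : ∀ x, deriv (fun t => toComplex (γ t)) x = toComplex (deriv γ x) := fun x =>
    (hasDerivAt_toComplex (hγ x).hasDerivAt).deriv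
  have hf := fun j => hT.iterate_succ_fst hp j
  have hm := fun j => hT.iterate_mem hp j
  refine ⟨fun j _ => ?_, fun j _ => ?_, fun j _ => ?_, fun j _ => ?_, ?_, ?_⟩
  · rw [hf]
    linarith [(hm j).1]
  · rw [hf]
    linarith [(hm j).2.1]
  · rw [hf, hd, hd, hper.deriv'.sub_int_mul_eq, hper.deriv'.sub_int_mul_eq, ← area_eq_cross]
    exact (hm j).2.2
  · obtain ⟨c, -, hc⟩ := (hT _ (hm j)).2.2
    rw [← Function.iterate_succ_apply' T j p] at hc
    rw [hd, hper.deriv'.sub_int_mul_eq]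
    simp only [hper.sub_int_mul_eq]
    rw [hf (j + 1), hf j, ← toComplex_sub, hc, ← area_eq_cross]
    simp [area]
    ring
  · simp only [hq, Prod.fst_add, Function.iterate_zero, id]
    ring
  · simp only [hf, hq, Prod.snd_add]
    simp only [Function.iterate_zero, id]
    ring

theorem IsEssentialCurve.exists_fst_eq {c : ℝ → ℝ × ℝ} (hL : 0 < L) (hc : IsEssentialCurve γ L c)
    (θ : ℝ) : ∃ u, (c u).1 = θ := by
  obtain ⟨hcont, -, ⟨k, hk, hck⟩, -⟩ := hc
  have hplus : ∀ n : ℕ, (c n).1 = (c 0).1 + n * (k * L) := by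
    intro n
    induction n with
    | zero => simp
    | succ n ih =>
      push_cast
      rw [hck, Prod.fst_add, ih]
      ring
  have hminus : ∀ n : ℕ, (c (-n)).1 = (c 0).1 - n * (k * L) := by
    intro n
    induction n with
    | zero => simp
    | succ n ih =>
      have := hck (-((n + 1 : ℕ) : ℝ))
      rw [show -((n + 1 : ℕ) : ℝ) + 1 = -(n : ℝ) by push_cast; ring] at this
      have h1 := congrArg Prod.fst this
      rw [Prod.fst_add, ih] at h1
      push_cast at h1 ⊢
      linarith
  have hk1 : 1 ≤ |(k : ℝ)| := one_le_abs_intCast hk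
  obtain ⟨n, hn⟩ := exists_nat_ge (|θ - (c 0).1| / L)
  rw [div_le_iff₀ hL] at hn
  have hn' : |θ - (c 0).1| ≤ |n * (k * L)| := by
    rw [abs_mul, abs_mul, abs_of_pos hL, Nat.abs_cast]
    have : (n : ℝ) * (1 * L) ≤ n * (|(k : ℝ)| * L) := by gcongr
    linarith
  have hcf : Continuous fun u => (c u).1 := continuous_fst.comp hcont
  have h1 := abs_le.1 hn'
  rcases le_total 0 ((n : ℝ) * (k * L)) with h | h
  · rw [abs_of_nonneg h] at h1
    exact mem_range_of_exists_le_of_exists_ge hcf ⟨-n, by rw [hminus]; linarith⟩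
      ⟨n, by rw [hplus]; linarith⟩
  · rw [abs_of_nonpos h] at h1
    exact mem_range_of_exists_le_of_exists_ge hcf ⟨n, by rw [hplus]; linarith⟩
      ⟨-n, by rw [hminus]; linarith⟩

/-- If the orbit of `p` has rotation number `1 / q` and the points `p + M (L, L)` are `q`-periodic,
then some of these points returns after exactly one turn. -/
theorem IsBilliardMap.exists_iterate_eq (hT : IsBilliardMap γ L T) (hL : 0 < L)
    (hper : Function.Periodic γ L) {p : ℝ × ℝ} (hp : p ∈ phase γ L) {q : ℕ} (hq : 0 < q)
    (hrot : HasRotationNumber L T p (1 / q))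
    (hpp : ∀ M : ℤ, IsPeriodicOrbit L T q (p + (M * L, M * L))) :
    ∃ M : ℤ, T^[q] (p + (M * L, M * L)) = p + (M * L, M * L) + (L, L) := by
  choose m hm using hpp
  by_contra! hne
  have h2 : ∀ M, 2 ≤ m M := by
    intro M
    have h1 := hT.iterate_fst_lt (add_mem_phase hper hp M) hq
    rw [hm] at h1
    have h1' : p.1 + M * L < p.1 + M * L + m M * L := h1
    rw [lt_add_iff_pos_right] at h1'
    have h3 : 0 < m M := by exact_mod_cast (pos_of_mul_pos_left h1' hL.le)
    have h4 : m M ≠ 1 := fun h => hne M (by rw [hm, h]; simp)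
    omega
  have hk : ∀ k : ℕ, ∃ M : ℤ, 2 * (k : ℤ) ≤ M ∧ T^[k * q] p = p + (M * L, M * L) := by
    intro k
    induction k with
    | zero => exact ⟨0, by simp, by simp⟩
    | succ k ih =>
      obtain ⟨M, hM, hMk⟩ := ih
      refine ⟨M + m M, by have := h2 M; push_cast; omega, ?_⟩
      rw [Nat.succ_mul, add_comm, Function.iterate_add_apply, hMk, hm, add_assoc]
      congr 1
      ext <;> simp <;> ring
  have hq' : (0 : ℝ) < q := by exact_mod_cast hq
  have hlim : Tendsto (fun k : ℕ => (T^[k * q] p).1 / ((k * q : ℕ) * L)) atTop (𝓝 (1 / q)) :=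
    Tendsto.comp hrot (tendsto_id.atTop_mul_const' hq)
  have hlim' : Tendsto (fun k : ℕ => p.1 / (q * L) / (k : ℝ) + 2 / q) atTop (𝓝 (0 + 2 / q)) :=
    (tendsto_const_div_atTop_nhds_zero_nat _).add tendsto_const_nhds
  have hle : ∀ᶠ k : ℕ in atTop,
      p.1 / (q * L) / (k : ℝ) + 2 / q ≤ (T^[k * q] p).1 / ((k * q : ℕ) * L) := by
    filter_upwards [eventually_gt_atTop 0] with k hk0
    have hk0' : (0 : ℝ) < k := by exact_mod_cast hk0
    obtain ⟨M, hM, hMk⟩ := hk k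
    have hM' : 2 * (k : ℝ) ≤ M := by exact_mod_cast hM
    rw [hMk, Prod.fst_add]
    have e : p.1 / (q * L) / (k : ℝ) + 2 / q = (p.1 + 2 * k * L) / ((k * q : ℕ) * L) := by
      push_cast
      field_simp
    rw [e]
    have : 2 * (k : ℝ) * L ≤ M * L := by gcongr
    gcongr
  have := le_of_tendsto_of_tendsto hlim' hlim hle
  rw [zero_add, div_le_div_iff_of_pos_right hq'] at this
  norm_num at this

theorem RationallyIntegrable.hasPolygons (h : RationallyIntegrable γ L) (hL : 0 < L)
    (hγ : Differentiable ℝ γ) (hper : Function.Periodic γ L) :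
    HasPolygons (fun t => toComplex (γ t)) L := by
  obtain ⟨T, hT, h⟩ := h
  intro q hq θ
  obtain ⟨c, hc, -, hp⟩ := h q hq
  obtain ⟨u, rfl⟩ := hc.exists_fst_eq hL θ
  have hu : c u ∈ phase γ L := hc.2.1 u
  have htr : ∀ M : ℤ, c u + (M * L, M * L) ∈ trace L c := fun M => ⟨u, M, rfl⟩
  obtain ⟨M, hM⟩ := hT.exists_iterate_eq hL hper hu (q := q) (by omega)
    (by have := (hp _ (htr 0)).1; simpa [Prod.mk_zero_zero] using this) fun M => (hp _ (htr M)).2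
  exact ⟨_, by simp, hT.isPolygon hγ hper (add_mem_phase hper hu M) hM M⟩

end Phase

theorem HasPolygons.transfer {γ₁ γ₂ : ℝ → ℂ} {L₁ L₂ : ℝ} (h₁ : HasPolygons γ₁ L₁) {h : ℝ → ℝ}
    (hmono : StrictMono h) (hsurj : Function.Surjective h) (hadd : ∀ x, h (x + L₁) = h x + L₂)
    (hpos : ∀ x y, 0 < cross (deriv γ₁ x) (deriv γ₁ y) →
      0 < cross (deriv γ₂ (h x)) (deriv γ₂ (h y)))
    (hcrit : ∀ x y z, cross (γ₁ z - γ₁ x) (deriv γ₁ y) = 0 →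
      cross (γ₂ (h z) - γ₂ (h x)) (deriv γ₂ (h y)) = 0) : HasPolygons γ₂ L₂ := by
  intro q hq θ
  obtain ⟨x, rfl⟩ := hsurj θ
  obtain ⟨t, rfl, ht⟩ := h₁ q hq x
  exact ⟨fun j => h (t j), rfl, fun j hj => hmono (ht.lt j hj),
    fun j hj => by rw [← hadd]; exact hmono (ht.lt_add j hj),
    fun j hj => hpos _ _ (ht.cross_pos j hj), fun j hj => hcrit _ _ _ (ht.critical j hj),
    by rw [ht.closed, hadd], by rw [ht.closed', hadd]⟩

/-- The real linear map of the plane with complex coefficients `A` and `B`. -/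
def affineL (A B : ℂ) : ℂ →L[ℝ] ℂ :=
  A • ContinuousLinearMap.id ℝ ℂ + B • (Complex.conjCLE : ℂ →L[ℝ] ℂ)

theorem affineL_apply (A B z : ℂ) : affineL A B z = A * z + B * (starRingEnd ℂ) z := rfl

theorem cross_affineL (A B z w : ℂ) : cross (affineL A B z) (affineL A B w) =
    (‖A‖ ^ 2 - ‖B‖ ^ 2) * cross z w := by
  rw [affineL_apply, affineL_apply, Complex.sq_norm, Complex.sq_norm, Complex.normSq_apply,
    Complex.normSq_apply]
  simp [cross]
  ring

theorem cross_smul_smul (a b : ℝ) (z w : ℂ) : cross (a • z) (b • w) = a * b * cross z w := by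
  simp [cross]; ring

theorem cross_smul_right (b : ℝ) (z w : ℂ) : cross z (b • w) = b * cross z w := by
  simp [cross]; ring

section Transfer

variable {γ₁ γ₂ : ℝ → ℂ} {L₁ L₂ : ℝ} {h : ℝ → ℝ} {A B D : ℂ}

theorem HasPolygons.of_affine_comp (h₁ : HasPolygons γ₁ L₁)
    (hsurj : Function.Surjective h) (hadd : ∀ x, h (x + L₁) = h x + L₂)
    (hd : Differentiable ℝ h) (hpos : ∀ x, 0 < deriv h x) (hAB : ‖B‖ < ‖A‖)
    (hγ : Differentiable ℝ γ₂) (heq : ∀ x, γ₁ x = affineL A B (γ₂ (h x)) + D) :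
    HasPolygons γ₂ L₂ := by
  have hκ : 0 < ‖A‖ ^ 2 - ‖B‖ ^ 2 := by nlinarith [norm_nonneg B, norm_nonneg A]
  have hder : ∀ x, deriv γ₁ x = affineL A B (deriv h x • deriv γ₂ (h x)) := fun x => by
    rw [funext heq]
    exact (((affineL A B).hasFDerivAt.comp_hasDerivAt x
      ((hγ (h x)).hasDerivAt.scomp x (hd x).hasDerivAt)).add_const D).deriv
  refine h₁.transfer (strictMono_of_deriv_pos hpos) hsurj hadd (fun x y hxy => ?_)
    fun x y z hxyz => ?_
  · rw [hder, hder, cross_affineL, cross_smul_smul] at hxy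
    exact pos_of_mul_pos_right (pos_of_mul_pos_right hxy hκ.le) (mul_pos (hpos x) (hpos y)).le
  · rw [hder, heq, heq, add_sub_add_right_eq_sub, ← map_sub, cross_affineL,
      cross_smul_right] at hxyz
    simpa [hκ.ne', (hpos y).ne'] using hxyz

theorem HasPolygons.of_comp_eq_affine (h₁ : HasPolygons γ₁ L₁)
    (hsurj : Function.Surjective h) (hadd : ∀ x, h (x + L₁) = h x + L₂)
    (hd : Differentiable ℝ h) (hpos : ∀ x, 0 < deriv h x) (hAB : ‖B‖ < ‖A‖)
    (hγ₁ : Differentiable ℝ γ₁) (hγ₂ : Differentiable ℝ γ₂)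
    (heq : ∀ x, γ₂ (h x) = affineL A B (γ₁ x) + D) : HasPolygons γ₂ L₂ := by
  have hκ : 0 < ‖A‖ ^ 2 - ‖B‖ ^ 2 := by nlinarith [norm_nonneg B, norm_nonneg A]
  have hder : ∀ x, deriv h x • deriv γ₂ (h x) = affineL A B (deriv γ₁ x) := fun x => by
    have h1 : HasDerivAt (fun x => γ₂ (h x)) (deriv h x • deriv γ₂ (h x)) x :=
      (hγ₂ (h x)).hasDerivAt.scomp x (hd x).hasDerivAt
    rw [funext heq] at h1
    exact h1.unique (((affineL A B).hasFDerivAt.comp_hasDerivAt x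
      (hγ₁ x).hasDerivAt).add_const D)
  refine h₁.transfer (strictMono_of_deriv_pos hpos) hsurj hadd (fun x y hxy => ?_)
    fun x y z hxyz => ?_
  · have := mul_pos hκ hxy
    rw [← cross_affineL, ← hder, ← hder, cross_smul_smul] at this
    exact pos_of_mul_pos_right this (mul_pos (hpos x) (hpos y)).le
  · have := cross_affineL A B (γ₁ z - γ₁ x) (deriv γ₁ y)
    rw [hxyz, mul_zero, ← hder, map_sub, ← add_sub_add_right_eq_sub _ _ D, ← heq, ← heq,
      cross_smul_right] at this
    simpa [(hpos y).ne'] using this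

end Transfer


namespace Ellipse

variable (E : Ellipse)

theorem alpha_pos : 0 < E.alpha := Real.rpow_pos_of_pos (mul_pos E.a_pos E.b_pos) _

theorem period_pos : 0 < E.period := mul_pos Real.two_pi_pos E.alpha_pos

/-- The holomorphic coefficient of the linear map from the unit circle to the ellipse. -/
def coeffA : ℂ := (((E.a + E.b) / 2 : ℝ) : ℂ) * Complex.exp (E.angle * Complex.I)

/-- The antiholomorphic coefficient of the linear map from the unit circle to the ellipse. -/
def coeffB : ℂ := (((E.a - E.b) / 2 : ℝ) : ℂ) * Complex.exp (E.angle * Complex.I)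

theorem norm_coeffB_lt : ‖E.coeffB‖ < ‖E.coeffA‖ := by
  have ha := E.a_pos
  have hb := E.b_pos
  rw [coeffA, coeffB, norm_mul, norm_mul, Complex.norm_exp_ofReal_mul_I, mul_one, mul_one,
    Complex.norm_real, Complex.norm_real, Real.norm_eq_abs, Real.norm_eq_abs,
    abs_of_pos (by positivity : 0 < (E.a + E.b) / 2), abs_lt]
  constructor <;> linarith

theorem toComplex_normal (t : ℝ) : toComplex (E.normal t) =
    affineL E.coeffA E.coeffB (Complex.exp (((t / E.alpha : ℝ) : ℂ) * Complex.I)) := by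
  rw [affineL_apply, coeffA, coeffB]
  apply Complex.ext
  · simp [toComplex, normal, Complex.exp_ofReal_mul_I_re, Complex.exp_ofReal_mul_I_im,
      -Complex.ofReal_div]
    ring
  · simp [toComplex, normal, Complex.exp_ofReal_mul_I_re, Complex.exp_ofReal_mul_I_im,
      -Complex.ofReal_div]
    ring

theorem toComplex_deform (n : ℝ → ℝ) (t : ℝ) : toComplex (E.deform n t) =
    affineL E.coeffA E.coeffB (polar (fun θ => n (E.alpha * θ)) (t / E.alpha)) +
      toComplex E.center := by
  have hα := E.alpha_pos.ne'
  rw [deform, param, toComplex_add, toComplex_add, toComplex_smul, toComplex_normal, polar,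
    mul_div_cancel₀ _ hα, ← Complex.real_smul (x := 1 + n t), map_smul, Complex.real_smul]
  push_cast
  ring

theorem toComplex_param (t : ℝ) : toComplex (E.param t) =
    affineL E.coeffA E.coeffB (Complex.exp (((t / E.alpha : ℝ) : ℂ) * Complex.I)) +
      toComplex E.center := by
  rw [param, toComplex_add, toComplex_normal, add_comm]

theorem differentiable_deform {n : ℝ → ℝ} (hn : Differentiable ℝ n) :
    Differentiable ℝ (E.deform n) := by
  have h1 : Differentiable ℝ E.normal := by unfold normal; fun_prop
  unfold deform param
  fun_prop

theorem normal_periodic : Function.Periodic E.normal E.period := fun t => by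
  have : (t + E.period) / E.alpha = t / E.alpha + 2 * Real.pi := by
    rw [period]
    field_simp [E.alpha_pos.ne']
  rw [normal, normal, this, Real.cos_add_two_pi, Real.sin_add_two_pi]

theorem deform_periodic {n : ℝ → ℝ} (hn : Function.Periodic n E.period) :
    Function.Periodic (E.deform n) E.period := fun t => by
  simp only [deform, param, E.normal_periodic t, hn t]

/-- Nondegenerate affine images of the unit circle are ellipses. -/
theorem exists_range_param {A B : ℂ} (hAB : ‖B‖ < ‖A‖) (D : ℂ) : ∃ E : Ellipse,
    ∀ x, x ∈ range E.param ↔ ∃ z : ℂ, ‖z‖ = 1 ∧ toComplex x = affineL A B z + D := by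
  set ψ := (A.arg + B.arg) / 2 with hψ
  set χ := (B.arg - A.arg) / 2 with hχ
  let E : Ellipse := ⟨!₂[D.re, D.im], ψ, ‖A‖ + ‖B‖, ‖A‖ - ‖B‖,
    by linarith [norm_nonneg B], by linarith⟩
  have hA : E.coeffA = A * Complex.exp (χ * Complex.I) := by
    have h1 : E.coeffA = ‖A‖ * Complex.exp (ψ * Complex.I) := by
      simp only [coeffA, E]
      congr 2
      ring
    rw [h1]
    nth_rewrite 2 [← Complex.norm_mul_exp_arg_mul_I A]
    rw [mul_assoc, ← Complex.exp_add, hψ, hχ]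
    congr 2
    push_cast
    ring
  have hB : E.coeffB = B * Complex.exp (-(χ * Complex.I)) := by
    have h1 : E.coeffB = ‖B‖ * Complex.exp (ψ * Complex.I) := by
      simp only [coeffB, E]
      congr 2
      ring
    rw [h1]
    nth_rewrite 2 [← Complex.norm_mul_exp_arg_mul_I B]
    rw [mul_assoc, ← Complex.exp_add, hψ, hχ]
    congr 2
    push_cast
    ring
  have hparam : ∀ t, toComplex (E.param t) =
      affineL A B (Complex.exp (((t / E.alpha + χ : ℝ) : ℂ) * Complex.I)) + D := by
    intro t
    have hc : toComplex E.center = D := rfl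
    rw [toComplex_param, hc, hA, hB, affineL_apply, affineL_apply, ← Complex.exp_conj,
      ← Complex.exp_conj, mul_assoc, mul_assoc, ← Complex.exp_add, ← Complex.exp_add]
    simp only [map_mul, Complex.conj_I, Complex.conj_ofReal]
    congr 3
    · congr 2
      push_cast
      ring
    · congr 2
      push_cast
      ring
  refine ⟨E, fun x => ⟨?_, ?_⟩⟩
  · rintro ⟨t, rfl⟩
    exact ⟨_, Complex.norm_exp_ofReal_mul_I _, hparam t⟩
  · rintro ⟨z, hz, hx⟩
    refine ⟨E.alpha * (z.arg - χ), toComplex_injective ?_⟩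
    rw [hparam, hx, mul_div_cancel_left₀ _ E.alpha_pos.ne', sub_add_cancel]
    nth_rewrite 2 [← Complex.norm_mul_exp_arg_mul_I z]
    rw [hz, Complex.ofReal_one, one_mul]

/-- The Minkowski functional of the ellipse, squared. -/
def gauge (x : Plane) : ℝ :=
  (((x 0 - E.center 0) * Real.cos E.angle + (x 1 - E.center 1) * Real.sin E.angle) / E.a) ^ 2 +
  ((-(x 0 - E.center 0) * Real.sin E.angle + (x 1 - E.center 1) * Real.cos E.angle) / E.b) ^ 2

theorem continuous_gauge : Continuous E.gauge := by
  unfold gauge; fun_prop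

theorem continuous_normal : Continuous E.normal := by
  unfold normal; fun_prop

theorem gauge_center_add (r t : ℝ) : E.gauge (E.center + r • E.normal t) = r ^ 2 := by
  have ha := E.a_pos.ne'
  have hb := E.b_pos.ne'
  have h1 := Real.sin_sq_add_cos_sq E.angle
  have h2 := Real.sin_sq_add_cos_sq (t / E.alpha)
  have e1 : r * (E.a * Real.cos (t / E.alpha) * Real.cos E.angle +
      -(E.b * Real.sin (t / E.alpha) * Real.sin E.angle)) * Real.cos E.angle +
      r * (E.a * Real.cos (t / E.alpha) * Real.sin E.angle +
      E.b * Real.sin (t / E.alpha) * Real.cos E.angle) * Real.sin E.angle =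
      r * Real.cos (t / E.alpha) * E.a := by
    linear_combination r * E.a * Real.cos (t / E.alpha) * h1
  have e2 : -(r * (E.a * Real.cos (t / E.alpha) * Real.cos E.angle +
      -(E.b * Real.sin (t / E.alpha) * Real.sin E.angle))) * Real.sin E.angle +
      r * (E.a * Real.cos (t / E.alpha) * Real.sin E.angle +
      E.b * Real.sin (t / E.alpha) * Real.cos E.angle) * Real.cos E.angle =
      r * Real.sin (t / E.alpha) * E.b := by
    linear_combination r * E.b * Real.sin (t / E.alpha) * h1
  simp only [gauge, normal, PiLp.add_apply, PiLp.smul_apply, smul_eq_mul, add_sub_cancel_left,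
    Matrix.cons_val_zero, Matrix.cons_val_one, Matrix.cons_val_fin_one, mul_neg]
  rw [e1, e2, mul_div_cancel_right₀ _ ha, mul_div_cancel_right₀ _ hb]
  linear_combination r ^ 2 * h2

theorem exists_eq_center_add (x : Plane) :
    ∃ r t : ℝ, 0 ≤ r ∧ x = E.center + r • E.normal t := by
  set z : ℂ := ⟨((x 0 - E.center 0) * Real.cos E.angle + (x 1 - E.center 1) * Real.sin E.angle) / E.a,
    (-(x 0 - E.center 0) * Real.sin E.angle + (x 1 - E.center 1) * Real.cos E.angle) / E.b⟩ with hz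
  refine ⟨‖z‖, E.alpha * z.arg, norm_nonneg _, ?_⟩
  have ha := E.a_pos.ne'
  have hb := E.b_pos.ne'
  have h1 := Real.sin_sq_add_cos_sq E.angle
  have hc : ‖z‖ * Real.cos z.arg * E.a =
      (x 0 - E.center 0) * Real.cos E.angle + (x 1 - E.center 1) * Real.sin E.angle := by
    rw [Complex.norm_mul_cos_arg, hz]
    exact div_mul_cancel₀ _ ha
  have hs : ‖z‖ * Real.sin z.arg * E.b =
      -(x 0 - E.center 0) * Real.sin E.angle + (x 1 - E.center 1) * Real.cos E.angle := by
    rw [Complex.norm_mul_sin_arg, hz]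
    exact div_mul_cancel₀ _ hb
  ext i
  rw [normal, mul_div_cancel_left₀ _ E.alpha_pos.ne']
  fin_cases i
  · simp only [Fin.zero_eta, PiLp.add_apply, PiLp.smul_apply, smul_eq_mul, Matrix.cons_val_zero]
    linear_combination -Real.cos E.angle * hc + Real.sin E.angle * hs - (x 0 - E.center 0) * h1
  · simp only [Fin.mk_one, PiLp.add_apply, PiLp.smul_apply, smul_eq_mul, Matrix.cons_val_one,
      Matrix.cons_val_fin_one]
    linear_combination -Real.sin E.angle * hc - Real.cos E.angle * hs - (x 1 - E.center 1) * h1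

theorem region_eq : E.region = {x | E.gauge x < 1} := by
  ext x
  constructor
  · rintro ⟨t, r, h0, h1, rfl⟩
    rw [mem_ofPred_eq, gauge_center_add]
    exact pow_lt_one₀ h0 h1 (by norm_num)
  · intro hx
    obtain ⟨r, t, h0, rfl⟩ := E.exists_eq_center_add x
    rw [mem_ofPred_eq, gauge_center_add] at hx
    exact ⟨t, r, h0, by nlinarith, rfl⟩

theorem range_param_eq : range E.param = {x | E.gauge x = 1} := by
  ext x
  constructor
  · rintro ⟨t, rfl⟩
    have := E.gauge_center_add 1 t
    rwa [one_smul, one_pow] at this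
  · intro hx
    obtain ⟨r, t, h0, rfl⟩ := E.exists_eq_center_add x
    rw [mem_ofPred_eq, gauge_center_add] at hx
    have : r = 1 := by nlinarith
    exact ⟨t, by rw [this, one_smul]; rfl⟩

theorem isPreconnected_image_center_add {s : Set ℝ} (hs : IsPreconnected s) :
    IsPreconnected ((fun p : ℝ × ℝ => E.center + p.1 • E.normal p.2) '' (s ×ˢ univ)) := by
  refine (hs.prod isPreconnected_univ).image _ (Continuous.continuousOn ?_)
  have := E.continuous_normal
  fun_prop

theorem isPreconnected_inside : IsPreconnected {x | E.gauge x < 1} := by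
  convert E.isPreconnected_image_center_add (isPreconnected_Ico (a := (0 : ℝ)) (b := 1)) using 1
  rw [← region_eq]
  ext x
  constructor
  · rintro ⟨t, r, h0, h1, rfl⟩
    exact ⟨(r, t), ⟨⟨h0, h1⟩, mem_univ _⟩, rfl⟩
  · rintro ⟨⟨r, t⟩, ⟨⟨h0, h1⟩, -⟩, rfl⟩
    exact ⟨t, r, h0, h1, rfl⟩

theorem isPreconnected_outside : IsPreconnected {x | 1 < E.gauge x} := by
  convert E.isPreconnected_image_center_add (isPreconnected_Ioi (a := (1 : ℝ))) using 1
  ext x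
  constructor
  · intro hx
    obtain ⟨r, t, h0, rfl⟩ := E.exists_eq_center_add x
    rw [mem_ofPred_eq, gauge_center_add] at hx
    exact ⟨(r, t), ⟨by rw [mem_Ioi]; nlinarith, mem_univ _⟩, rfl⟩
  · rintro ⟨⟨r, t⟩, ⟨h1, -⟩, rfl⟩
    rw [mem_ofPred_eq, gauge_center_add]
    exact one_lt_pow₀ h1 (by norm_num)

theorem not_isBounded_outside : ¬ Bornology.IsBounded {x | 1 < E.gauge x} := by
  intro hb
  have hbd : Bornology.IsBounded (E.gauge '' closure {x | 1 < E.gauge x}) :=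
    ((Metric.isCompact_of_isClosed_isBounded isClosed_closure hb.closure).image
      E.continuous_gauge).isBounded
  obtain ⟨C, hC⟩ := hbd.bddAbove
  have hmem : E.center + (|C| + 2) • E.normal 0 ∈ {x | 1 < E.gauge x} := by
    rw [mem_ofPred_eq, gauge_center_add]
    nlinarith [abs_nonneg C]
  have := hC ⟨_, subset_closure hmem, rfl⟩
  rw [gauge_center_add] at this
  nlinarith [abs_nonneg C, le_abs_self C]

/-- An open set whose frontier misses a preconnected set contains it once they meet. -/
theorem _root_.IsPreconnected.subset_of_disjoint_frontier {X : Type*} [TopologicalSpace X]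
    {s t : Set X} (hs : IsPreconnected s) (ht : IsOpen t) (hd : Disjoint s (frontier t))
    (hne : (s ∩ t).Nonempty) : s ⊆ t := by
  refine hs.subset_left_of_subset_union ht (isClosed_closure (s := t)).isOpen_compl
    (disjoint_compl_right.mono_left subset_closure) (fun x hx => ?_) hne
  by_cases hxt : x ∈ closure t
  · left
    by_contra h
    exact hd.le_bot ⟨hx, by rw [ht.frontier_eq]; exact ⟨hxt, h⟩⟩
  · exact Or.inr hxt

theorem eq_region_of_frontier_eq {Ω : Set Plane} (ho : IsOpen Ω) (hc : IsConnected Ω)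
    (hb : Bornology.IsBounded Ω) (hf : frontier Ω = range E.param) : Ω = E.region := by
  have hg := E.continuous_gauge
  rw [range_param_eq] at hf
  have hdisj : ∀ s : Set Plane, (∀ x ∈ s, E.gauge x ≠ 1) → Disjoint s (frontier Ω) := by
    intro s hs
    rw [hf, Set.disjoint_left]
    exact hs
  have hΩ : ∀ x ∈ Ω, E.gauge x ≠ 1 := by
    intro x hx h1
    have : x ∈ frontier Ω := by rw [hf]; exact h1
    rw [ho.frontier_eq] at this
    exact this.2 hx
  have hout : ∀ x ∈ Ω, E.gauge x < 1 := by
    intro x hx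
    by_contra! h
    have hx1 : 1 < E.gauge x := lt_of_le_of_ne h (hΩ x hx).symm
    exact E.not_isBounded_outside (hb.subset (E.isPreconnected_outside.subset_of_disjoint_frontier
      ho (hdisj _ fun y hy => ne_of_gt hy) ⟨x, hx1, hx⟩))
  obtain ⟨x, hx⟩ := hc.nonempty
  rw [region_eq]
  exact Subset.antisymm hout (E.isPreconnected_inside.subset_of_disjoint_frontier ho
    (hdisj _ fun y hy => ne_of_lt hy) ⟨x, hout x hx, hx⟩)

end Ellipse


theorem affineL_affineL (P Q A B z : ℂ) : affineL P Q (affineL A B z) =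
    affineL (P * A + Q * (starRingEnd ℂ) B) (P * B + Q * (starRingEnd ℂ) A) z := by
  simp only [affineL_apply, map_add, map_mul, Complex.conj_conj]
  ring

theorem norm_lt_norm_of_comp {P Q A B : ℂ} (h : ‖Q‖ < ‖P‖) (h' : ‖B‖ < ‖A‖) :
    ‖P * B + Q * (starRingEnd ℂ) A‖ < ‖P * A + Q * (starRingEnd ℂ) B‖ := by
  have e : ‖P * A + Q * (starRingEnd ℂ) B‖ ^ 2 - ‖P * B + Q * (starRingEnd ℂ) A‖ ^ 2 =
      (‖P‖ ^ 2 - ‖Q‖ ^ 2) * (‖A‖ ^ 2 - ‖B‖ ^ 2) := by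
    simp only [Complex.sq_norm, Complex.normSq_apply]
    simp
    ring
  have h1 : 0 < ‖P‖ ^ 2 - ‖Q‖ ^ 2 := by nlinarith [norm_nonneg P, norm_nonneg Q]
  have h2 : 0 < ‖A‖ ^ 2 - ‖B‖ ^ 2 := by nlinarith [norm_nonneg A, norm_nonneg B]
  have h3 := mul_pos h1 h2
  rw [← e] at h3
  exact lt_of_pow_lt_pow_left₀ 2 (norm_nonneg _) (by linarith)

theorem exists_affineL_inverse {A B : ℂ} (h : ‖B‖ < ‖A‖) :
    ∃ A' B' : ℂ, ‖B'‖ < ‖A'‖ ∧ ∀ z, affineL A' B' (affineL A B z) = z := by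
  have hΔ : 0 < ‖A‖ ^ 2 - ‖B‖ ^ 2 := by nlinarith [norm_nonneg A, norm_nonneg B]
  set Δ := ‖A‖ ^ 2 - ‖B‖ ^ 2 with hΔdef
  have hΔ' : (Δ : ℂ) ≠ 0 := by exact_mod_cast hΔ.ne'
  refine ⟨(starRingEnd ℂ) A / Δ, -B / Δ, ?_, fun z => ?_⟩
  · rw [norm_div, norm_div, norm_neg, RCLike.norm_conj]
    have : 0 < ‖(Δ : ℂ)‖ := norm_pos_iff.2 hΔ'
    gcongr
  · have e : (Δ : ℂ) = (starRingEnd ℂ) A * A - (starRingEnd ℂ) B * B := by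
      rw [Complex.conj_mul', Complex.conj_mul', hΔdef]
      push_cast
      ring
    rw [affineL_affineL, affineL_apply]
    field_simp
    rw [e]
    ring

/-- The curves, affine maps and tolerances to which the reparametrization theorem applies. -/
structure NormalizedCurve (α K : ℝ) where
  n : ℝ → ℝ
  A : ℂ
  B : ℂ
  D : ℂ
  μ : ℝ
  contDiff : ContDiff ℝ 127 n
  periodic : Function.Periodic (fun θ => n (α * θ)) (2 * Real.pi)
  iteratedDeriv_le : ∀ j ≤ 127, ∀ x, |iteratedDeriv j n x| ≤ K
  μ_le : μ ≤ 1 / 100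
  abs_le : ∀ θ, |n (α * θ)| ≤ μ
  abs_deriv_le : ∀ θ, |deriv (fun θ => n (α * θ)) θ| ≤ μ
  A_le : ‖A - 1‖ ≤ μ
  B_le : ‖B‖ ≤ μ
  D_le : ‖D‖ ≤ μ

theorem uniformlyBounded_normalizedCurve (α K : ℝ) :
    UniformlyBounded 20 fun (i : NormalizedCurve α K) θ => i.n (α * θ) := by
  have h1 : UniformlyBounded 20 fun i : NormalizedCurve α K => i.n :=
    UniformlyBounded.of_contDiff (C := K) (fun i => i.contDiff.of_le (by
      exact_mod_cast (by norm_num : (20 : ℕ) ≤ 127)))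
      fun i j hj x => i.iteratedDeriv_le j (by omega) x
  have hd : ∀ x, HasDerivAt (fun θ : ℝ => α * θ) α x := fun x => by
    simpa using (hasDerivAt_id x).const_mul α
  refine h1.comp (m := 19) (h := fun _ θ => α * θ) (fun _ x => (hd x).differentiableAt) ?_
  have : (fun _ : NormalizedCurve α K => deriv fun θ : ℝ => α * θ) = fun _ _ => α :=
    funext fun _ => funext fun x => (hd x).deriv
  rw [this]
  exact UniformlyBounded.const (C := ‖α‖) fun _ => le_rfl

theorem differentiable_polar {ν : ℝ → ℝ} (h : Differentiable ℝ ν) : Differentiable ℝ (polar ν) := by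
  intro θ
  have h1 : HasDerivAt (fun θ : ℝ => ((1 + ν θ : ℝ) : ℂ)) (deriv ν θ : ℝ) θ :=
    ((h θ).hasDerivAt.const_add 1).ofReal_comp
  have h2 : HasDerivAt (fun θ : ℝ => (θ : ℂ) * Complex.I) (1 * Complex.I) θ :=
    (hasDerivAt_id θ).ofReal_comp.mul_const _
  exact (h1.mul h2.cexp).differentiableAt

theorem norm_logPolar (s : ℝ → ℝ) (t : ℝ) : ‖logPolar s t‖ = Real.exp (s t) := by
  rw [logPolar, Complex.norm_exp]
  simp

/-- A nearly circular curve that has billiard polygons with any number of vertices through each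
point is an affine image of the circle. -/
theorem exists_affine_circle {α : ℝ} (hα : 0 < α) (K : ℝ) : ∃ ε : ℝ, 0 < ε ∧ ∀ n : ℝ → ℝ,
    ContDiff ℝ 127 n → Function.Periodic n (2 * Real.pi * α) →
    (∀ j ≤ 127, ∀ x, |iteratedDeriv j n x| ≤ K) → (∀ x, |n x| ≤ ε) → (∀ x, |deriv n x| ≤ ε) →
    HasPolygons (polar fun θ => n (α * θ)) (2 * Real.pi) →
    ∃ A B D : ℂ, ‖B‖ < ‖A‖ ∧ ∃ h : ℝ → ℝ, Function.Surjective h ∧ ∀ θ,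
      affineL A B (polar (fun θ => n (α * θ)) θ) + D = Complex.exp (h θ * Complex.I) := by
  obtain ⟨h, s, ⟨K', hK'⟩, hprop⟩ := exists_reparam (m := 19)
    (ν := fun (i : NormalizedCurve α K) θ => i.n (α * θ)) (fun i => i.μ_le)
    (uniformlyBounded_normalizedCurve α K) (fun i => i.periodic) (fun i => i.abs_le)
    (fun i => i.abs_deriv_le) (fun i => i.A_le) (fun i => i.B_le) (fun i => i.D_le)
  obtain ⟨ε₁, hε₁, hcore⟩ := eq_zero_of_hasPolygons K'
  have hlr : 0 < lowModeRatio := by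
    have := one_le_tsum_weight
    unfold lowModeRatio
    positivity
  obtain ⟨μ, hμ0, hμ1, hμ2, hμ3⟩ : ∃ μ : ℝ, 0 < μ ∧ μ ≤ 1 / 100 ∧ 8 * μ ≤ ε₁ ∧
      44 * μ ≤ lowModeRatio := by
    refine ⟨min (1 / 100) (min (ε₁ / 8) (lowModeRatio / 44)), by positivity, min_le_left _ _, ?_, ?_⟩
    · have : min (1 / 100) (min (ε₁ / 8) (lowModeRatio / 44)) ≤ ε₁ / 8 :=
        (min_le_right _ _).trans (min_le_left _ _)
      linarith
    · have : min (1 / 100) (min (ε₁ / 8) (lowModeRatio / 44)) ≤ lowModeRatio / 44 :=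
        (min_le_right _ _).trans (min_le_right _ _)
      linarith
  obtain ⟨ε₂, hε₂, hquad⟩ := exists_affine_of_quadPoly hμ0
  obtain ⟨η, hη, hmom⟩ := exists_quadPoly_moments_eq_zero hε₂
  refine ⟨min η (min μ (μ / α)), by positivity, fun n hn hper hnK hn0 hn1 hpol => ?_⟩
  have hd : ∀ x, HasDerivAt (fun θ : ℝ => n (α * θ)) (deriv n (α * x) * α) x := fun x => by
    have h1 : HasDerivAt (fun θ : ℝ => α * θ) α x := by
      simpa using (hasDerivAt_id x).const_mul α
    exact ((hn.differentiable (by norm_num)) (α * x)).hasDerivAt.comp x h1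
  have hdν : Differentiable ℝ fun θ : ℝ => n (α * θ) := fun x => (hd x).differentiableAt
  obtain ⟨v, hv, hmv⟩ := hmom _ hdν.continuous fun θ => (hn0 _).trans (min_le_left _ _)
  obtain ⟨A, B, D, R, hR, hA, hB, hD, hABD⟩ := hquad v hv
  have hBA : ‖B‖ < ‖A‖ := by
    have := norm_sub_norm_le 1 (1 - A)
    rw [sub_sub_cancel, norm_one, norm_sub_rev] at this
    linarith
  let i : NormalizedCurve α K :=
    { n := n, A := A, B := B, D := D, μ := μ
      contDiff := hn
      periodic := fun θ => by
        show n (α * (θ + 2 * Real.pi)) = n (α * θ)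
        rw [show α * (θ + 2 * Real.pi) = α * θ + 2 * Real.pi * α by ring, hper]
      iteratedDeriv_le := hnK
      μ_le := hμ1
      abs_le := fun θ => (hn0 _).trans ((min_le_right _ _).trans (min_le_left _ _))
      abs_deriv_le := fun θ => by
        rw [(hd θ).deriv, abs_mul, abs_of_pos hα, ← le_div_iff₀ hα]
        exact (hn1 _).trans ((min_le_right _ _).trans (min_le_right _ _))
      A_le := hA.le, B_le := hB.le, D_le := hD.le }
  obtain ⟨hrep, hsper, hsd, hs8, heq⟩ := hprop i
  set ν : ℝ → ℝ := fun θ => n (α * θ) with hν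
  have heq' : ∀ θ, logPolar (s i) (h i θ) = affineL A B (polar ν θ) + D := heq
  refine ⟨A, B, D, hBA, h i, hrep.surjective, fun θ => ?_⟩
  have hpol' : HasPolygons (logPolar (s i)) (2 * Real.pi) :=
    hpol.of_comp_eq_affine hrep.surjective hrep.add_two_pi hrep.differentiable
      (fun x => by linarith [hrep.deriv_ge hμ1 x]) hBA (differentiable_polar hdν)
      (fun x => (hasDerivAt_logPolar (hsd x).hasDerivAt).differentiableAt) heq'
  have hΦ : ∀ θ, Real.exp (2 * s i (h i θ)) - 1 =
      R⁻¹ * (‖polar ν θ‖ ^ 2 - 1 + quadPoly v (polar ν θ)) := by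
    intro θ
    rw [hABD, inv_mul_cancel_left₀ hR, ← affineL_apply, ← heq', norm_logPolar, ← Real.exp_nat_mul]
    norm_num
  have hΦc : Continuous fun θ => Real.exp (2 * s i (h i θ)) - 1 := by
    have := hsd.continuous
    have := hrep.differentiable.continuous
    fun_prop
  have hΦm : ∀ j, ∫ θ in (0 : ℝ)..(2 * Real.pi), (Real.exp (2 * s i (h i θ)) - 1) *
      quadMonomial j (Complex.exp (θ * Complex.I)) = 0 := by
    intro j
    simp only [hΦ, mul_assoc]
    rw [intervalIntegral.integral_const_mul, hmv j, mul_zero]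
  have hzero := hcore (s i) (hK' i) hsper (fun x => (hs8 x).trans hμ2) hpol' fun X hX k hk => by
    have hX0 : 0 ≤ X := (abs_nonneg _).trans (hX 0)
    refine (hrep.norm_fourierC_le hμ1 hsd.continuous hsper hs8 hX hk
      (fourierC_eq_zero_of_moments hΦc hΦm hk)).trans ?_
    gcongr
  rw [← heq', logPolar, hzero]
  simp

theorem abs_iteratedDeriv_le_normC {L : ℝ} (hL : 0 < L) {n : ℝ → ℝ} {N k j : ℕ}
    (hn : ContDiff ℝ N n) (hper : Function.Periodic n L) (hk : k ≤ N) (hj : j ≤ k) (x : ℝ) :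
    |iteratedDeriv j n x| ≤ normC L k n := by
  have hpj : Function.Periodic (iteratedDeriv j n) L := by
    clear hj
    induction j with
    | zero => simpa using hper
    | succ j ih => rw [iteratedDeriv_succ]; exact ih.deriv'
  obtain ⟨y, hy, hxy⟩ := hpj.exists_mem_Ico₀ hL x
  have hcont : Continuous fun x => |iteratedDeriv j n x| :=
    (hn.continuous_iteratedDeriv j (by exact_mod_cast hj.trans hk)).abs
  have h1 : |iteratedDeriv j n y| ≤ sSup ((fun x => |iteratedDeriv j n x|) '' Icc 0 L) :=
    le_csSup (isCompact_Icc.image hcont).bddAbove ⟨y, Ico_subset_Icc_self hy, rfl⟩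
  rw [hxy]
  refine h1.trans (Finset.single_le_sum
    (f := fun j => sSup ((fun x => |iteratedDeriv j n x|) '' Icc 0 L)) (fun i _ => ?_)
    (Finset.mem_range.2 (by omega)))
  refine Real.sSup_nonneg ?_
  rintro _ ⟨z, -, rfl⟩
  exact abs_nonneg _


end SymplecticBilliard

end

theorem theorem1 (E : SymplecticBilliard.Ellipse) (K : ℝ) (hK : 0 < K) :
    ∃ ε : ℝ, 0 < ε ∧ ∀ (Ω : Set SymplecticBilliard.Plane) (n : ℝ → ℝ),
      IsOpen Ω → IsConnected Ω → Bornology.IsBounded Ω →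
      ContDiff ℝ 127 n → Function.Periodic n E.period →
      frontier Ω = Set.range (E.deform n) →
      SymplecticBilliard.normC E.period 127 n ≤ K →
      SymplecticBilliard.normC E.period 1 n ≤ ε →
      SymplecticBilliard.RationallyIntegrable (E.deform n) E.period →
      ∃ E' : SymplecticBilliard.Ellipse, Ω = E'.region := by
  open SymplecticBilliard in
  obtain ⟨ε, hε, hmain⟩ := exists_affine_circle E.alpha_pos K
  refine ⟨ε, hε, fun Ω n ho hc hb hn hper hf hnK hnε hint => ?_⟩
  have hα := E.alpha_pos
  have hnd : Differentiable ℝ n := hn.differentiable (by norm_num)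
  have hdiv : ∀ x, HasDerivAt (fun t : ℝ => t / E.alpha) (1 / E.alpha) x := fun x =>
    (hasDerivAt_id x).div_const _
  have hνd : Differentiable ℝ fun θ => n (E.alpha * θ) :=
    hnd.comp (differentiable_id.const_mul E.alpha)
  have hpol : HasPolygons (polar fun θ => n (E.alpha * θ)) (2 * Real.pi) :=
    (hint.hasPolygons E.period_pos (E.differentiable_deform hnd)
      (E.deform_periodic hper)).of_affine_comp (h := fun t => t / E.alpha)
      (fun θ => ⟨E.alpha * θ, mul_div_cancel_left₀ _ hα.ne'⟩)
      (fun x => by simp only [Ellipse.period]; field_simp) (fun x => (hdiv x).differentiableAt)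
      (fun x => by rw [(hdiv x).deriv]; positivity) E.norm_coeffB_lt (differentiable_polar hνd)
      (E.toComplex_deform n)
  have hbound := fun {k j : ℕ} (hk : k ≤ 127) (hj : j ≤ k) (x : ℝ) =>
    abs_iteratedDeriv_le_normC E.period_pos (N := 127) (by exact_mod_cast hn) hper hk hj x
  obtain ⟨A, B, D, hBA, h, hsurj, hcirc⟩ := hmain n hn hper
    (fun j hj x => (hbound le_rfl hj x).trans hnK)
    (fun x => by simpa using (hbound (k := 1) (j := 0) (by norm_num) (by norm_num) x).trans hnε)
    (fun x => by
      simpa [iteratedDeriv_one] using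
        (hbound (k := 1) (j := 1) (by norm_num) le_rfl x).trans hnε) hpol
  obtain ⟨A', B', hBA', hinv⟩ := exists_affineL_inverse hBA
  set P := E.coeffA * A' + E.coeffB * (starRingEnd ℂ) B' with hP
  set Q := E.coeffA * B' + E.coeffB * (starRingEnd ℂ) A' with hQ
  obtain ⟨E', hE'⟩ := Ellipse.exists_range_param (norm_lt_norm_of_comp E.norm_coeffB_lt hBA')
    (toComplex E.center - affineL P Q D)
  have hdef : ∀ t, toComplex (E.deform n t) =
      affineL P Q (Complex.exp (h (t / E.alpha) * Complex.I)) +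
        (toComplex E.center - affineL P Q D) := by
    intro t
    have h1 := hcirc (t / E.alpha)
    rw [E.toComplex_deform, ← h1, map_add, hP, hQ, ← affineL_affineL, hinv]
    ring
  refine ⟨E', E'.eq_region_of_frontier_eq ho hc hb ?_⟩
  rw [hf]
  ext x
  rw [hE']
  constructor
  · rintro ⟨t, rfl⟩
    exact ⟨_, Complex.norm_exp_ofReal_mul_I _, hdef t⟩
  · rintro ⟨z, hz, hx⟩
    obtain ⟨θ, hθ⟩ := hsurj z.arg
    refine ⟨E.alpha * θ, toComplex_injective ?_⟩
    rw [hdef, hx, mul_div_cancel_left₀ _ hα.ne', hθ]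
    nth_rewrite 2 [← Complex.norm_mul_exp_arg_mul_I z]
    rw [hz, Complex.ofReal_one, one_mul]
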